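/- Let $k\ge 3$ be an integer and let $p(s)=\sum_{j=k+1}^{m}a_j s^j$ with $m\in\mathbb N$ and $a_j\in\mathbb R$ ($p=0$ if $m\le k$). There is $\epsilon=\epsilon(k,p)>0$ with the following property. Let $u=u(t,x)$ be a real-valued function with $$u\in C\big(\mathbb R:H^4(\mathbb R)\cap L^2(|x|^4dx)\big)\cap C^1\big(\mathbb R:H^2(\mathbb R)\cap L^2(|x|^2dx)\big)$$ that solves the initial value problem for the generalized Benjamin–Ono equation $$\partial_t u+\mathcal H\partial_x^2u+\partial_x\big(u^k+p(u)\big)=0,\quad t,x\in\mathbb R,\qquad u(0,\cdot)=u_0,$$ where $\mathcal H$ is the Hilbert transform, $\widehat{\mathcal Hf}(\xi)=-i\,\mathrm{sgn}(\xi)\,\widehat f(\xi)$ with $\widehat f(\xi)=\int e^{-2\pi i x\xi}f(x)\,dx$. If $$0\neq\|u_0\|_{H^{1/2}}<\epsilon,\qquad \|f\|_{H^{s}}:=\big\|(1+\xi^2)^{s/2}\widehat f(\xi)\big\|_{L^2},$$ then $u$ is not periodic in time: there is no $\omega>0$ such that $u(t+\omega,\cdot)=u(t,\cdot)$ for all $t\in\mathbb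 R$. -/

import Mathlib

open MeasureTheory Filter Topology
open scoped FourierTransform SchwartzMap LineDeriv ENNReal

noncomputable section

namespace GBO

/-- Real-valued `L²(ℝ)`. -/
abbrev L2R := Lp ℝ 2 (volume : Measure ℝ)

/-- Complex-valued `L²(ℝ)`. -/
abbrev L2C := Lp ℂ 2 (volume : Measure ℝ)

/-- A real `L²` function regarded as a complex-valued one. -/
def toC (f : L2R) : L2C := Complex.ofRealCLM.compLp f

/-- The symbol `-i sgn ξ` of the Hilbert transform. -/
def hilbertSymbol (ξ : ℝ) : ℂ := -Complex.I * ((SignType.sign ξ : ℝ) : ℂ)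

theorem memLp_hilbertSymbol : MemLp hilbertSymbol ∞ (volume : Measure ℝ) := by
  have hs : Measurable (fun ξ : ℝ => ((SignType.sign ξ : SignType) : ℝ)) := by
    have h : (fun ξ : ℝ => ((SignType.sign ξ : SignType) : ℝ)) =
        fun ξ => if 0 < ξ then 1 else if ξ < 0 then -1 else 0 := by
      funext ξ
      rcases lt_trichotomy ξ 0 with h | h | h
      · simp [h, h.not_gt]
      · simp [h]
      · simp [h]
    rw [h]
    exact Measurable.ite measurableSet_Ioi measurable_const
      (Measurable.ite measurableSet_Iio measurable_const measurable_const)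
  refine memLp_top_of_bound (C := 1) ?_ ?_
  · exact (measurable_const.mul (Complex.measurable_ofReal.comp hs)).aestronglyMeasurable
  · refine Eventually.of_forall fun ξ => ?_
    rcases lt_trichotomy ξ 0 with h | h | h <;> simp [hilbertSymbol, h]

/-- The Hilbert transform on `L²(ℝ)`: `Hf = (-i sgn(ξ) f̂)^∨`,
with `f̂(ξ) = ∫ e^{-2πixξ} f(x) dx`. -/
def hilbertTransform (f : L2C) : L2C :=
  𝓕⁻ ((memLp_hilbertSymbol.toLp hilbertSymbol : Lp ℂ ∞ (volume : Measure ℝ)) • (𝓕 f : L2C))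

/-- `g ∈ L²` is the (distributional) derivative `∂ₓ f` of `f ∈ L²`. -/
def IsDeriv (f g : L2C) : Prop :=
  ∂_{(1 : ℝ)} (f : 𝓢'(ℝ, ℂ)) = (g : 𝓢'(ℝ, ℂ))

/-- The norm `‖f‖_{s,2} = ‖(1 + ξ²)^{s/2} f̂‖₂` of `H^s(ℝ)`, equal to `∞` if `f ∉ H^s(ℝ)`. -/
def sobolevNorm (s : ℝ) (f : L2R) : ℝ≥0∞ :=
  eLpNorm (fun ξ : ℝ => (((1 + ξ ^ 2) ^ (s / 2) : ℝ) : ℂ) * (𝓕 (toC f) : L2C) ξ) 2 volume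

/-- The norm `(∫ |f(x)|² |x|^{2n} dx)^{1/2}` of `L²(|x|^{2n} dx)`, equal to `∞` if `f` is not in
that space. -/
def weightNorm (n : ℕ) (f : L2R) : ℝ≥0∞ :=
  eLpNorm (fun x : ℝ => |x| ^ n * f x) 2 volume

/-- The norm of `H^s(ℝ) ∩ L²(|x|^{2n} dx)`, equal to `∞` outside this space. -/
def normX (s : ℝ) (n : ℕ) (f : L2R) : ℝ≥0∞ :=
  sobolevNorm s f + weightNorm n f

/-- `u ∈ C(ℝ : H^s(ℝ) ∩ L²(|x|^{2n} dx))`. -/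
def ContinuousIntoX (s : ℝ) (n : ℕ) (u : ℝ → L2R) : Prop :=
  ∀ t, normX s n (u t) < ∞ ∧ Tendsto (fun τ => normX s n (u τ - u t)) (𝓝 t) (𝓝 0)

/-- `u` maps into `H^s(ℝ) ∩ L²(|x|^{2n} dx)` and is differentiable there, with derivative `v`. -/
def HasDerivIntoX (s : ℝ) (n : ℕ) (u v : ℝ → L2R) : Prop :=
  ∀ t, normX s n (u t) < ∞ ∧ normX s n (v t) < ∞ ∧
    Tendsto (fun h : ℝ => normX s n (h⁻¹ • (u (t + h) - u t) - v t)) (𝓝[≠] 0) (𝓝 0)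

/-- `p_k(s) = ∑_{j=k+1}^m a_j s^j`. -/
def perturbation (k m : ℕ) (a : ℕ → ℝ) (s : ℝ) : ℝ :=
  ∑ j ∈ Finset.Icc (k + 1) m, a j * s ^ j

/-- The equation `v + H ∂ₓ² u + ∂ₓ (g(u)) = 0` in `L²(ℝ)`, where `g : ℝ → ℝ` and `v` stands for
`∂ₜ u`; here `w₁ = ∂ₓ u`, `w₂ = ∂ₓ² u`, `F = g(u)` and `F₁ = ∂ₓ (g(u))`. -/
def Equation (g : ℝ → ℝ) (u v : L2R) : Prop :=
  ∃ w₁ w₂ F F₁ : L2C, IsDeriv (toC u) w₁ ∧ IsDeriv w₁ w₂ ∧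
    (∀ᵐ x : ℝ, F x = ((g (u x) : ℝ) : ℂ)) ∧ IsDeriv F F₁ ∧
    toC v + hilbertTransform w₂ + F₁ = 0

/-- `u` is a real solution, in the class
`C(ℝ : H⁴(ℝ) ∩ L²(|x|⁴ dx)) ∩ C¹(ℝ : H²(ℝ) ∩ L²(|x|² dx))`, of the initial value problem
`∂ₜ u + H ∂ₓ² u + ∂ₓ (u^k + p(u)) = 0`, `u(0) = u₀`. -/
structure IsSolution (k : ℕ) (p : ℝ → ℝ) (u₀ : L2R) (u : ℝ → L2R) : Prop where
  continuous_H4 : ContinuousIntoX 4 2 u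
  initial : u 0 = u₀
  equation : ∃ v : ℝ → L2R, HasDerivIntoX 2 1 u v ∧ ContinuousIntoX 2 1 v ∧
    ∀ t, Equation (fun s => s ^ k + p s) (u t) (v t)

/-- `u` is periodic in time with some period `ω > 0`. -/
def TimePeriodic (u : ℝ → L2R) : Prop :=
  ∃ ω : ℝ, 0 < ω ∧ Function.Periodic u ω

end GBO

end

/-!
Small nonzero solutions of the generalized Benjamin–Ono equation are not time-periodic because the
virial quantity `V(t) = ∫ x u²` is strictly increasing along them. With `g(s) = s^k + p(s)`, `G' = g`,
`K'(s) = s g'(s)`, `G(0) = K(0) = 0` and `A = ∫ |ξ| |û|²`, the equation gives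
* `d/dt ∫ u² = 0` (`mass_identity`);
* `d/dt (π A + ∫ G(u)) = 0` (`energy_identity`);
* `d/dt V = 2 (2π A + ∫ K(u))` (`virial_identity`).
The dispersive term of the last identity is computed on the Fourier side, where it is an
integration by parts of `ξ|ξ| ∂_ξ |û|²`.

Since `k ≥ 3`, all monomials of `G` and `K` have degree at least four, and the
Gagliardo–Nirenberg inequality `∫ |u|^q ≤ C_q ‖u‖_{H^{1/2}}^{q-2} A` for `q ≥ 4`
(`lintegral_enorm_pow_le`) makes `∫ G(u)` and `∫ K(u)` small multiples of `A` as long as `u` is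
small in `H^{1/2}`. It is proved by splitting `u` at a frequency `R(λ) ~ λ^{q-2}` chosen such that
the low frequencies are bounded by `λ/2`, and integrating the resulting bound of the distribution
function of `u` against `λ^{q-1} dλ`. Conservation of mass and energy together with continuity in
time then propagate smallness from `t = 0` to all times (`lt_of_conserved`), so that
`V' ≥ 3π A ≥ 0`. If `u` is periodic then so is `V`; being monotone, it is constant, and hence
`A = 0`, which forces `u(0) = 0`.
-/

open MeasureTheory Filter Topology
open scoped FourierTransform SchwartzMap LineDeriv ENNReal

namespace GBO

open Real

/-! ### The Fourier transform on `L²(ℝ)` and distributional derivatives -/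

theorem ae_eq_of_integral_schwartz_eq {f g : ℝ → ℂ} (hf : LocallyIntegrable f volume)
    (hg : LocallyIntegrable g volume) (h : ∀ φ : 𝓢(ℝ, ℂ), ∫ x, φ x • f x = ∫ x, φ x • g x) :
    f =ᵐ[volume] g := by
  refine ae_eq_of_integral_contDiff_smul_eq hf hg fun φ hφ hc => ?_
  have hg₁ : HasCompactSupport (Complex.ofRealCLM ∘ φ) := hc.comp_left rfl
  have hg₂ : ContDiff ℝ ((⊤ : ℕ∞) : WithTop ℕ∞) (Complex.ofRealCLM ∘ φ) :=
    Complex.ofRealCLM.contDiff.comp hφ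
  simpa using h (hg₁.toSchwartzMap hg₂)

theorem locallyIntegrable_L2 (f : L2C) : LocallyIntegrable f volume :=
  (Lp.memLp f).locallyIntegrable (by norm_num)

theorem eq_of_toTemperedDistribution_eq {f g : L2C}
    (h : (f : 𝓢'(ℝ, ℂ)) = (g : 𝓢'(ℝ, ℂ))) : f = g := by
  refine Lp.ext (ae_eq_of_integral_schwartz_eq (locallyIntegrable_L2 f)
    (locallyIntegrable_L2 g) fun φ => ?_)
  have := congrArg (fun T : 𝓢'(ℝ, ℂ) => T φ) h
  simpa using this

theorem continuous_fourier_of_integrable {f : ℝ → ℂ} (hf : Integrable f) :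
    Continuous (𝓕 f) :=
  VectorFourier.fourierIntegral_continuous Real.continuous_fourierChar
    (by fun_prop) hf

/-- The `L²` Fourier transform of a function in `L¹ ∩ L²` is given by the Fourier integral. -/
theorem fourier_ae_eq_of_integrable {f : L2C} (hf : Integrable f) :
    (𝓕 f : L2C) =ᵐ[volume] 𝓕 (f : ℝ → ℂ) := by
  refine ae_eq_of_integral_schwartz_eq (locallyIntegrable_L2 _)
    (continuous_fourier_of_integrable hf).locallyIntegrable fun φ => ?_
  have h := congrArg (fun T : 𝓢'(ℝ, ℂ) => T φ) (Lp.fourier_toTemperedDistribution_eq f)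
  simp only [TemperedDistribution.fourier_apply, Lp.toTemperedDistribution_apply] at h
  rw [← h, SchwartzMap.fourier_coe]
  simpa using! VectorFourier.integral_fourierIntegral_smul_eq_flip (L := innerₗ ℝ)
    Real.continuous_fourierChar continuous_inner φ.integrable hf

/-- The `L²` inverse Fourier transform of a function in `L¹ ∩ L²` is given by the inverse Fourier
integral. -/
theorem fourierInv_ae_eq_of_integrable {f : L2C} (hf : Integrable f) :
    (𝓕⁻ f : L2C) =ᵐ[volume] 𝓕⁻ (f : ℝ → ℂ) := by
  have hc : Continuous (𝓕⁻ (f : ℝ → ℂ)) := by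
    rw [show 𝓕⁻ (f : ℝ → ℂ) = fun x => 𝓕 (f : ℝ → ℂ) (-x) from
      funext fun x => fourierInv_eq_fourier_neg _ _]
    exact (continuous_fourier_of_integrable hf).comp continuous_neg
  refine ae_eq_of_integral_schwartz_eq (locallyIntegrable_L2 _) hc.locallyIntegrable fun φ => ?_
  have h := congrArg (fun T : 𝓢'(ℝ, ℂ) => T φ) (Lp.fourierInv_toTemperedDistribution_eq f)
  simp only [TemperedDistribution.fourierInv_apply, Lp.toTemperedDistribution_apply] at h
  rw [← h, SchwartzMap.fourierInv_coe]
  have h2 : ∫ x, 𝓕 (φ : ℝ → ℂ) x • f (-x) = ∫ x, φ x • 𝓕 (fun y => f (-y)) x := by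
    simpa using! VectorFourier.integral_fourierIntegral_smul_eq_flip (L := innerₗ ℝ)
      Real.continuous_fourierChar continuous_inner φ.integrable hf.comp_neg
  calc ∫ x, 𝓕⁻ (φ : ℝ → ℂ) x • f x = ∫ x, 𝓕 (φ : ℝ → ℂ) x • f (-x) := by
        rw [← integral_neg_eq_self]
        simp [fourierInv_eq_fourier_neg]
    _ = _ := by
        rw [h2]
        simp [fourierInv_eq_fourier_comp_neg]

/-- The distributional derivative corresponds to multiplication by `2πiξ`. -/
theorem IsDeriv.fourier {f g : L2C} (h : IsDeriv f g) :
    ∀ᵐ ξ : ℝ, (𝓕 g : L2C) ξ = 2 * π * Complex.I * ξ * (𝓕 f : L2C) ξ := by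
  refine ae_eq_of_integral_schwartz_eq (locallyIntegrable_L2 _) ?_ fun φ => ?_
  · exact (locallyIntegrable_L2 _).continuous_mul (by fun_prop)
  have h1 := TemperedDistribution.fourier_lineDerivOp_eq (f : 𝓢'(ℝ, ℂ)) (1 : ℝ)
  rw [show ∂_{(1 : ℝ)} (f : 𝓢'(ℝ, ℂ)) = (g : 𝓢'(ℝ, ℂ)) from h,
    Lp.fourier_toTemperedDistribution_eq, Lp.fourier_toTemperedDistribution_eq] at h1
  have h2 := congrArg (fun T : 𝓢'(ℝ, ℂ) => T φ) h1
  have hg : (fun x : ℝ => ((inner ℝ x (1 : ℝ) : ℝ) : ℂ)).HasTemperateGrowth := by fun_prop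
  simp only [Lp.toTemperedDistribution_apply, smul_apply,
    TemperedDistribution.smulLeftCLM_apply_apply] at h2
  rw [h2, smul_eq_mul, ← integral_const_mul]
  refine integral_congr_ae (Eventually.of_forall fun ξ => ?_)
  simp only [SchwartzMap.smulLeftCLM_apply_apply hg, smul_eq_mul]
  simp
  ring

/-- The classical derivative of a differentiable function is its distributional derivative. -/
theorem isDeriv_of_hasDerivAt {f g : L2C} {φ φ' : ℝ → ℂ} (hφ : ∀ x, HasDerivAt φ (φ' x) x)
    (hf : f =ᵐ[volume] φ) (hg : g =ᵐ[volume] φ') : IsDeriv f g := by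
  have hf2 : MemLp φ 2 volume := (Lp.memLp f).ae_eq hf
  have hg2 : MemLp φ' 2 volume := (Lp.memLp g).ae_eq hg
  unfold IsDeriv
  ext ψ
  rw [TemperedDistribution.lineDerivOp_apply_apply, Lp.toTemperedDistribution_apply,
    Lp.toTemperedDistribution_apply]
  have e1 : ∫ x, (-∂_{(1 : ℝ)} ψ) x • f x = -∫ x, deriv ψ x * φ x := by
    rw [← integral_neg]
    refine integral_congr_ae (hf.mono fun x hx => ?_)
    simp only [hx]
    simp [SchwartzMap.lineDerivOp_apply_eq_fderiv]
  have e2 : ∫ x, ψ x • g x = ∫ x, ψ x * φ' x :=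
    integral_congr_ae (hg.mono fun x hx => by simp [hx])
  rw [e2]
  have hd : ∀ x, HasDerivAt ψ (deriv ψ x) x := fun x => ψ.differentiableAt.hasDerivAt
  have hψ : MemLp ψ 2 volume := ψ.memLp 2 volume
  have hψ' : MemLp (deriv ψ) 2 volume := (SchwartzMap.derivCLM ℂ ℂ ψ).memLp 2 volume
  rw [integral_mul_deriv_eq_deriv_mul_of_integrable (fun x _ => hd x) (fun x _ => hφ x)
    (hψ.integrable_mul hg2) (hψ'.integrable_mul hf2) (hψ.integrable_mul hf2)]
  exact e1

theorem IsDeriv.ae_eq_of_hasDerivAt {f g : L2C} {φ φ' : ℝ → ℂ}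
    (hφ : ∀ x, HasDerivAt φ (φ' x) x) (h2 : MemLp φ' 2 volume) (hf : f =ᵐ[volume] φ)
    (h : IsDeriv f g) : g =ᵐ[volume] φ' := by
  have h1 : IsDeriv f (h2.toLp φ') := isDeriv_of_hasDerivAt hφ hf h2.coeFn_toLp
  have : g = h2.toLp φ' := eq_of_toTemperedDistribution_eq (h.symm.trans h1)
  rw [this]
  exact h2.coeFn_toLp

theorem toC_coe (f : L2R) : ∀ᵐ x : ℝ, toC f x = ((f x : ℝ) : ℂ) :=
  Complex.ofRealCLM.coeFn_compLp f

theorem toC_sub (f g : L2R) : toC (f - g) = toC f - toC g :=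
  map_sub (Complex.ofRealCLM.compLpL 2 (volume : Measure ℝ)) f g

theorem toC_smul (c : ℝ) (f : L2R) : toC (c • f) = c • toC f :=
  map_smul (Complex.ofRealCLM.compLpL 2 (volume : Measure ℝ)) c f

theorem norm_toC (f : L2R) : ‖toC f‖ = ‖f‖ := by
  rw [Lp.norm_def, Lp.norm_def]
  congr 1
  exact eLpNorm_congr_norm_ae ((toC_coe f).mono fun x hx => by simp [hx])

theorem hilbertTransform_fourier (f : L2C) :
    ∀ᵐ ξ : ℝ, (𝓕 (hilbertTransform f) : L2C) ξ = hilbertSymbol ξ * (𝓕 f : L2C) ξ := by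
  unfold hilbertTransform
  rw [FourierTransform.fourier_fourierInv_eq]
  filter_upwards [Lp.coeFn_lpSMul (r := 2) (memLp_hilbertSymbol.toLp hilbertSymbol) (𝓕 f : L2C),
    memLp_hilbertSymbol.coeFn_toLp] with ξ h1 h2
  rw [h1, Pi.smul_apply', h2, smul_eq_mul]

/-! ### A Gagliardo–Nirenberg inequality in `H^{1/2}(ℝ)` -/

theorem lintegral_enorm_sq_eq {α : Type*} [MeasurableSpace α] {μ : Measure α} {E : Type*}
    [NormedAddCommGroup E] (f : Lp E 2 μ) :
    ∫⁻ x, ‖f x‖ₑ ^ 2 ∂μ = ‖f‖ₑ ^ 2 := by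
  have h := eLpNorm_nnreal_pow_eq_lintegral (f := f) (μ := μ) (p := 2) (by norm_num)
  rw [Lp.enorm_def]
  simpa using h.symm

theorem lintegral_fourier_enorm_sq (f : L2C) :
    ∫⁻ ξ, ‖(𝓕 f : L2C) ξ‖ₑ ^ 2 = ∫⁻ x, ‖f x‖ₑ ^ 2 := by
  rw [lintegral_enorm_sq_eq, lintegral_enorm_sq_eq]
  congr 1
  rw [← ofReal_norm, ← ofReal_norm, Lp.norm_fourier_eq]

theorem lintegral_Ioc_rpow {p R : ℝ} (hp : -1 < p) (hR : 0 ≤ R) :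
    ∫⁻ x in Set.Ioc 0 R, ENNReal.ofReal (x ^ p) = ENNReal.ofReal (R ^ (p + 1) / (p + 1)) := by
  rw [← ofReal_integral_eq_lintegral_ofReal]
  · rw [← intervalIntegral.integral_of_le hR, integral_rpow (Or.inl hp),
      zero_rpow (by linarith), sub_zero]
  · rw [← IntegrableOn, ← intervalIntegrable_iff_integrableOn_Ioc_of_le hR]
    exact intervalIntegral.intervalIntegrable_rpow' hp
  · exact (ae_restrict_mem measurableSet_Ioc).mono fun x hx => rpow_nonneg hx.1.le _

theorem lintegral_ball_abs_rpow_le {p R : ℝ} (hp : -1 < p) (hR : 0 ≤ R) :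
    ∫⁻ x in {x : ℝ | |x| < R}, ENNReal.ofReal (|x| ^ p) ≤
      ENNReal.ofReal (2 * (R ^ (p + 1) / (p + 1))) := by
  have hpos : ∫⁻ x in Set.Ioc 0 R, ENNReal.ofReal (|x| ^ p) =
      ENNReal.ofReal (R ^ (p + 1) / (p + 1)) := by
    rw [← lintegral_Ioc_rpow hp hR]
    exact setLIntegral_congr_fun measurableSet_Ioc fun x hx => by simp [abs_of_pos hx.1]
  have hneg : ∫⁻ x in Neg.neg ⁻¹' Set.Ioc 0 R, ENNReal.ofReal (|x| ^ p) =
      ENNReal.ofReal (R ^ (p + 1) / (p + 1)) := by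
    rw [← hpos, ← (Measure.measurePreserving_neg (volume : Measure ℝ)).setLIntegral_comp_preimage
      measurableSet_Ioc (by fun_prop)]
    simp
  have hsub : {x : ℝ | |x| < R} ⊆ (Set.Ioc 0 R ∪ Neg.neg ⁻¹' Set.Ioc 0 R) ∪ {0} := by
    intro x hx
    simp only [Set.mem_ofPred_eq, abs_lt] at hx
    rcases lt_trichotomy x 0 with h | h | h
    · left; right; constructor <;> linarith
    · right; simpa using h
    · left; left; exact ⟨h, hx.2.le⟩
  have hnn : 0 ≤ R ^ (p + 1) / (p + 1) := div_nonneg (rpow_nonneg hR _) (by linarith)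
  calc _ ≤ ∫⁻ x in (Set.Ioc 0 R ∪ Neg.neg ⁻¹' Set.Ioc 0 R) ∪ {0}, ENNReal.ofReal (|x| ^ p) :=
        lintegral_mono_set hsub
    _ ≤ _ := lintegral_union_le _ _ _
    _ ≤ ((∫⁻ x in Set.Ioc 0 R, ENNReal.ofReal (|x| ^ p)) +
          ∫⁻ x in Neg.neg ⁻¹' Set.Ioc 0 R, ENNReal.ofReal (|x| ^ p)) + 0 := by
        gcongr
        · exact lintegral_union_le _ _ _
        · simp
    _ = _ := by rw [hpos, hneg, add_zero, ← ENNReal.ofReal_add hnn hnn, two_mul]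

/-- Bound of the `L¹` norm of the low frequencies, by Cauchy–Schwarz with the weight `|ξ|^{2a}`,
where `a = 1/2 - 1/r`. -/
theorem lintegral_low_frequency_le {F : ℝ → ℂ} (hF : AEStronglyMeasurable F volume) {r : ℝ}
    (hr : 2 ≤ r) {B : ℝ} (hB : 0 ≤ B)
    (h : ∫⁻ ξ, ENNReal.ofReal (1 + |ξ|) * ‖F ξ‖ₑ ^ 2 ≤ ENNReal.ofReal B) {R : ℝ} (hR : 0 ≤ R) :
    ∫⁻ ξ in {ξ : ℝ | |ξ| < R}, ‖F ξ‖ₑ ≤ ENNReal.ofReal (√(B * r) * R ^ (1 / r)) := by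
  set a : ℝ := 1 / 2 - 1 / r with ha
  have hr0 : 0 < r := by linarith
  have hr1 : 1 / r ≤ 1 / 2 := by gcongr
  have hr2 : 0 < 1 / r := by positivity
  set S := {ξ : ℝ | |ξ| < R}
  have hle : ∫⁻ ξ in S, ‖F ξ‖ₑ =
      ∫⁻ ξ in S, ENNReal.ofReal (|ξ| ^ a) * ‖F ξ‖ₑ * ENNReal.ofReal (|ξ| ^ (-a)) := by
    refine lintegral_congr_ae (ae_restrict_of_ae ?_)
    filter_upwards [show ∀ᵐ ξ : ℝ, ξ ≠ 0 from by simp [ae_iff]] with ξ hξ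
    have h0 : 0 < |ξ| := abs_pos.2 hξ
    rw [mul_right_comm, ← ENNReal.ofReal_mul (by positivity), ← rpow_add h0]
    simp
  have hCS := ENNReal.lintegral_mul_le_Lp_mul_Lq (volume.restrict S)
    (p := 2) (q := 2) ⟨by norm_num, by norm_num, by norm_num⟩
    (f := fun ξ => ENNReal.ofReal (|ξ| ^ a) * ‖F ξ‖ₑ) (g := fun ξ => ENNReal.ofReal (|ξ| ^ (-a)))
    (AEMeasurable.mul (by fun_prop) hF.enorm.restrict) (by fun_prop)
  rw [hle]
  refine hCS.trans ?_
  have h1 : ∫⁻ ξ in S, (ENNReal.ofReal (|ξ| ^ a) * ‖F ξ‖ₑ) ^ (2 : ℝ) ≤ ENNReal.ofReal B := by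
    refine (setLIntegral_le_lintegral _ _).trans (le_trans (lintegral_mono fun ξ => ?_) h)
    rw [ENNReal.mul_rpow_of_nonneg _ _ (by norm_num), ENNReal.rpow_two ‖F ξ‖ₑ]
    gcongr
    rw [ENNReal.ofReal_rpow_of_nonneg (by positivity) (by norm_num), ← rpow_mul (abs_nonneg _)]
    refine ENNReal.ofReal_le_ofReal ?_
    rcases le_total |ξ| 1 with h1 | h1
    · have := rpow_le_one (abs_nonneg ξ) h1 (z := a * 2) (by linarith)
      linarith [abs_nonneg ξ]
    · have := rpow_le_rpow_of_exponent_le h1 (y := a * 2) (z := 1) (by linarith)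
      rw [rpow_one] at this
      linarith
  have h2 : ∫⁻ ξ in S, (ENNReal.ofReal (|ξ| ^ (-a))) ^ (2 : ℝ) ≤
      ENNReal.ofReal (r * R ^ (2 / r)) := by
    have e : ∀ ξ : ℝ, (ENNReal.ofReal (|ξ| ^ (-a))) ^ (2 : ℝ) = ENNReal.ofReal (|ξ| ^ (-a * 2)) := by
      intro ξ
      rw [ENNReal.ofReal_rpow_of_nonneg (by positivity) (by norm_num), ← rpow_mul (abs_nonneg _)]
    simp_rw [e]
    refine (lintegral_ball_abs_rpow_le (by linarith) hR).trans (le_of_eq ?_)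
    have e2 : -a * 2 + 1 = 2 / r := by rw [ha]; ring
    rw [e2]
    congr 1
    field_simp
  calc _ ≤ (ENNReal.ofReal B) ^ (1 / 2 : ℝ) * (ENNReal.ofReal (r * R ^ (2 / r))) ^ (1 / 2 : ℝ) := by
        gcongr
    _ = _ := by
        rw [ENNReal.ofReal_rpow_of_nonneg hB (by norm_num),
          ENNReal.ofReal_rpow_of_nonneg (by positivity) (by norm_num),
          ← ENNReal.ofReal_mul (by positivity), mul_rpow hr0.le (by positivity),
          ← rpow_mul hR, sqrt_eq_rpow, mul_rpow hB hr0.le]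
        congr 1
        rw [show 2 / r * (1 / 2) = 1 / r by ring]
        ring

/-- Splitting `f` into its frequencies below and above `R`: the low part is at most `λ/2`, so
Chebyshev's inequality for the high part bounds the distribution function of `f` at `λ`. -/
theorem measure_lt_enorm_le (f : L2C) {R l : ℝ} (hl : 0 < l)
    (h : ∫⁻ ξ in {ξ : ℝ | |ξ| < R}, ‖(𝓕 f : L2C) ξ‖ₑ ≤ ENNReal.ofReal (l / 2)) :
    volume {x | l < ‖f x‖} ≤
      ENNReal.ofReal (4 / l ^ 2) * ∫⁻ ξ in {ξ : ℝ | R ≤ |ξ|}, ‖(𝓕 f : L2C) ξ‖ₑ ^ 2 := by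
  set F : L2C := 𝓕 f with hF
  have hS : MeasurableSet {ξ : ℝ | |ξ| < R} := measurableSet_lt (by fun_prop) (by fun_prop)
  have hlow : MemLp ({ξ : ℝ | |ξ| < R}.indicator F) 2 volume := (Lp.memLp F).indicator hS
  set G : L2C := hlow.toLp _ with hG
  have hGc : G =ᵐ[volume] {ξ : ℝ | |ξ| < R}.indicator F := hlow.coeFn_toLp
  have hGi : ∫⁻ ξ, ‖G ξ‖ₑ ≤ ENNReal.ofReal (l / 2) := by
    refine le_trans (le_of_eq ?_) h
    rw [← lintegral_indicator hS]
    refine lintegral_congr_ae (hGc.mono fun ξ hξ => ?_)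
    simp only [hξ, enorm_indicator_eq_indicator_enorm]
  have hGint : Integrable G :=
    ⟨Lp.aestronglyMeasurable G, lt_of_le_of_lt hGi ENNReal.ofReal_lt_top⟩
  have hbd : ∀ᵐ x, ‖(𝓕⁻ G : L2C) x‖ ≤ l / 2 := by
    filter_upwards [fourierInv_ae_eq_of_integrable hGint] with x hx
    rw [hx, fourierInv_eq]
    calc _ ≤ ∫ ξ, ‖G ξ‖ := by
          refine (norm_integral_le_integral_norm _).trans (le_of_eq ?_)
          simp
      _ ≤ l / 2 := by
          rw [integral_norm_eq_lintegral_enorm (Lp.aestronglyMeasurable G)]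
          exact ENNReal.toReal_le_of_le_ofReal (by positivity) hGi
  set H : L2C := f - 𝓕⁻ G with hH
  have hHF : 𝓕 H = F - G := by
    have e := (Lp.fourierTransformₗᵢ ℝ ℂ).map_sub f (𝓕⁻ G)
    have e2 : (Lp.fourierTransformₗᵢ ℝ ℂ) (𝓕⁻ G) = G :=
      (Lp.fourierTransformₗᵢ ℝ ℂ).apply_symm_apply G
    rw [e2] at e
    exact e
  have hsub : volume {x | l < ‖f x‖} ≤ volume {x | ENNReal.ofReal (l ^ 2 / 4) ≤ ‖H x‖ₑ ^ 2} := by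
    refine measure_mono_ae ?_
    filter_upwards [hbd, Lp.coeFn_sub f (𝓕⁻ G)] with x hx hx2 hlx
    have hlx' : l < ‖f x‖ := hlx
    have : ‖f x‖ - ‖(𝓕⁻ G : L2C) x‖ ≤ ‖H x‖ := by
      rw [hH, hx2]; exact norm_sub_norm_le _ _
    change ENNReal.ofReal (l ^ 2 / 4) ≤ ‖H x‖ₑ ^ 2
    rw [← ofReal_norm, ← ENNReal.ofReal_pow (norm_nonneg _)]
    refine ENNReal.ofReal_le_ofReal ?_
    nlinarith
  refine hsub.trans ?_
  have hch := meas_ge_le_lintegral_div (μ := volume) (f := fun x => ‖H x‖ₑ ^ 2)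
    ((Lp.aestronglyMeasurable H).enorm.pow_const 2) (ε := ENNReal.ofReal (l ^ 2 / 4))
    (ne_of_gt (ENNReal.ofReal_pos.2 (by positivity))) ENNReal.ofReal_ne_top
  refine hch.trans ?_
  rw [← lintegral_fourier_enorm_sq, hHF, ENNReal.div_eq_inv_mul,
    ← ENNReal.ofReal_inv_of_pos (by positivity), inv_div]
  refine mul_le_mul_right ?_ _
  rw [← lintegral_indicator (measurableSet_le (by fun_prop) (by fun_prop))]
  refine lintegral_mono_ae ?_
  filter_upwards [Lp.coeFn_sub F G, hGc] with ξ h1 h2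
  rw [h1, Pi.sub_apply, h2]
  by_cases hξ : |ξ| < R
  · simp [Set.indicator, hξ]
  · simp [Set.indicator, hξ, not_lt.1 hξ]

/-- The Gagliardo–Nirenberg inequality `‖f‖_q^q ≤ C ‖f‖_{H^{1/2}}^{q-2} ‖D^{1/2} f‖₂²`, `q ≥ 4`. -/
theorem lintegral_enorm_pow_le (n : ℕ) (f : L2C) {B : ℝ} (hB : 0 < B)
    (h : ∫⁻ ξ, ENNReal.ofReal (1 + |ξ|) * ‖(𝓕 f : L2C) ξ‖ₑ ^ 2 ≤ ENNReal.ofReal B) :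
    ∫⁻ x, ‖f x‖ₑ ^ (n + 4) ≤
      ENNReal.ofReal (4 * (n + 4) / (n + 2) * √(4 * B * (n + 2)) ^ (n + 2)) *
        ∫⁻ ξ, ENNReal.ofReal |ξ| * ‖(𝓕 f : L2C) ξ‖ₑ ^ 2 := by
  set F : L2C := 𝓕 f with hF
  set σ : ℝ := √(4 * B * (n + 2)) with hσ
  have hσ0 : 0 < σ := by positivity
  have hn : (0 : ℝ) < n + 2 := by positivity
  have hFm : AEMeasurable (fun ξ => ‖F ξ‖ₑ ^ 2) volume :=
    (Lp.aestronglyMeasurable F).enorm.pow_const _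
  have hlayer : ∫⁻ x, ‖f x‖ₑ ^ (n + 4) = ∫⁻ l in Set.Ioi 0, volume {x | l < ‖f x‖} *
      ENNReal.ofReal ((n + 4) * l ^ (n + 3)) := by
    rw [← lintegral_comp_eq_lintegral_meas_lt_mul volume (f := fun x => ‖f x‖)
      (g := fun l => (n + 4) * l ^ (n + 3))]
    · refine lintegral_congr fun x => ?_
      rw [intervalIntegral.integral_const_mul, integral_pow, ← ofReal_norm,
        ← ENNReal.ofReal_pow (norm_nonneg _)]
      congr 1
      push_cast
      field_simp
      ring
    · exact Eventually.of_forall fun x => norm_nonneg _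
    · exact (Lp.aestronglyMeasurable f).norm.aemeasurable
    · intro t _
      exact Continuous.intervalIntegrable (by fun_prop) _ _
    · refine (ae_restrict_mem measurableSet_Ioi).mono fun l hl => ?_
      have : (0 : ℝ) < l := hl
      positivity
  have hdist : ∀ l : ℝ, 0 < l → volume {x | l < ‖f x‖} ≤
      ENNReal.ofReal (4 / l ^ 2) *
        ∫⁻ ξ in {ξ : ℝ | (l / σ) ^ (n + 2) ≤ |ξ|}, ‖F ξ‖ₑ ^ 2 := by
    intro l hl
    refine measure_lt_enorm_le f hl ?_
    refine (lintegral_low_frequency_le (Lp.aestronglyMeasurable F) (r := (n : ℝ) + 2)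
      (by linarith [Nat.cast_nonneg (α := ℝ) n]) hB.le h (by positivity)).trans ?_
    refine ENNReal.ofReal_le_ofReal (le_of_eq ?_)
    have e1 : ((l / σ) ^ (n + 2)) ^ (1 / ((n : ℝ) + 2)) = l / σ := by
      rw [← rpow_natCast, ← rpow_mul (by positivity)]
      push_cast
      rw [mul_one_div_cancel hn.ne', rpow_one]
    have e2 : σ = 2 * √(B * (n + 2)) := by
      rw [hσ, show 4 * B * ((n : ℝ) + 2) = 2 ^ 2 * (B * (n + 2)) by ring,
        sqrt_mul (by positivity), sqrt_sq (by norm_num)]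
    have e3 : 0 < √(B * (n + 2)) := by positivity
    rw [e1, e2]
    field_simp
  have hpt : ∀ l ∈ Set.Ioi (0 : ℝ), volume {x | l < ‖f x‖} *
      ENNReal.ofReal ((n + 4) * l ^ (n + 3)) ≤
      ∫⁻ ξ, ENNReal.ofReal (4 * (n + 4)) * (ENNReal.ofReal (l ^ (n + 1)) *
        Set.indicator {p : ℝ × ℝ | (p.1 / σ) ^ (n + 2) ≤ |p.2|} 1 (l, ξ)) * ‖F ξ‖ₑ ^ 2 := by
    intro l hl
    have hl0 : (0 : ℝ) < l := hl
    refine (mul_le_mul_left (hdist l hl0) _).trans (le_of_eq ?_)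
    rw [mul_right_comm, ← ENNReal.ofReal_mul (by positivity),
      ← lintegral_indicator (measurableSet_le (by fun_prop) (by fun_prop)),
      ← lintegral_const_mul' _ _ ENNReal.ofReal_ne_top]
    refine lintegral_congr fun ξ => ?_
    by_cases hξ : (l / σ) ^ (n + 2) ≤ |ξ|
    · simp only [Set.indicator, Set.mem_ofPred_eq, hξ, if_true, Pi.one_apply, mul_one]
      rw [← ENNReal.ofReal_mul (by positivity)]
      congr 2
      field_simp
      ring
    · simp [Set.indicator, hξ]
  rw [hlayer]
  refine (setLIntegral_mono' measurableSet_Ioi hpt).trans ?_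
  have hind : Measurable (Set.indicator {p : ℝ × ℝ | (p.1 / σ) ^ (n + 2) ≤ |p.2|}
      (1 : ℝ × ℝ → ℝ≥0∞)) :=
    measurable_one.indicator (measurableSet_le (by fun_prop) (by fun_prop))
  rw [lintegral_lintegral_swap]
  · rw [← lintegral_const_mul' _ _ ENNReal.ofReal_ne_top]
    refine lintegral_mono fun ξ => ?_
    have hin : ∫⁻ l in Set.Ioi (0 : ℝ), ENNReal.ofReal (l ^ (n + 1)) *
        Set.indicator {p : ℝ × ℝ | (p.1 / σ) ^ (n + 2) ≤ |p.2|} 1 (l, ξ) ≤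
        ENNReal.ofReal (σ ^ (n + 2) * |ξ| / (n + 2)) := by
      set Λ : ℝ := σ * |ξ| ^ (1 / ((n : ℝ) + 2)) with hΛ
      have hΛ0 : 0 ≤ Λ := by positivity
      have hΛn : Λ ^ (n + 2) = σ ^ (n + 2) * |ξ| := by
        rw [hΛ, mul_pow, ← rpow_natCast (|ξ| ^ _), ← rpow_mul (abs_nonneg _)]
        push_cast
        rw [one_div_mul_cancel hn.ne', rpow_one]
      calc _ ≤ ∫⁻ l in Set.Ioi (0 : ℝ), Set.indicator (Set.Ioc 0 Λ)
            (fun l => ENNReal.ofReal (l ^ ((n : ℝ) + 1))) l := by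
            refine setLIntegral_mono' measurableSet_Ioi fun l hl => ?_
            have hl0 : (0 : ℝ) < l := hl
            by_cases hξ : (l / σ) ^ (n + 2) ≤ |ξ|
            · have hlΛ : l ≤ Λ := by
                refine le_of_pow_le_pow_left₀ (n := n + 2) (by omega) hΛ0 ?_
                rw [hΛn]
                rw [div_pow, div_le_iff₀ (by positivity)] at hξ
                linarith
              rw [Set.indicator_of_mem (show l ∈ Set.Ioc 0 Λ from ⟨hl0, hlΛ⟩),
                Set.indicator_of_mem (by exact hξ), Pi.one_apply, mul_one]
              refine le_of_eq ?_
              congr 1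
              rw [← rpow_natCast]
              push_cast
              rfl
            · rw [Set.indicator_of_notMem (by exact hξ), mul_zero]
              exact zero_le
        _ = ∫⁻ l in Set.Ioc 0 Λ, ENNReal.ofReal (l ^ ((n : ℝ) + 1)) := by
            rw [lintegral_indicator measurableSet_Ioc, Measure.restrict_restrict measurableSet_Ioc,
              Set.inter_eq_left.2 fun l hl => hl.1]
        _ = _ := by
            rw [lintegral_Ioc_rpow (by linarith) hΛ0, ← hΛn, ← rpow_natCast Λ]
            congr 2
            · push_cast; congr 1; ring
            · ring
    rw [lintegral_mul_const'' _ (by fun_prop), lintegral_const_mul _ (by fun_prop)]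
    calc _ ≤ ENNReal.ofReal (4 * (n + 4)) * ENNReal.ofReal (σ ^ (n + 2) * |ξ| / (n + 2)) *
          ‖F ξ‖ₑ ^ 2 := by gcongr
      _ = _ := by
        rw [← ENNReal.ofReal_mul (by positivity), ← mul_assoc, ← ENNReal.ofReal_mul (by positivity)]
        congr 2
        ring
  · refine AEMeasurable.mul ?_ ?_
    · exact Measurable.aemeasurable (by fun_prop)
    · exact hFm.comp_snd

/-! ### Regularity and decay from Sobolev and weighted norms -/

theorem memLp_two_of_norm_sq_le {E : Type*} [NormedAddCommGroup E] {m : ℝ → E}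
    (hm : AEStronglyMeasurable m volume)
    (h : ∀ x, ‖m x‖ ^ 2 ≤ (1 + x ^ 2)⁻¹) : MemLp m 2 volume := by
  rw [memLp_two_iff_integrable_sq_norm hm]
  refine integrable_inv_one_add_sq.mono' (hm.norm.pow 2) (Eventually.of_forall fun x => ?_)
  simpa using h x

theorem memLp_two_inv_one_add_sq :
    MemLp (fun x : ℝ => (((1 + x ^ 2)⁻¹ : ℝ) : ℂ)) 2 volume := by
  refine memLp_two_of_norm_sq_le (Measurable.aestronglyMeasurable (by fun_prop)) fun x => ?_
  rw [Complex.norm_real, norm_of_nonneg (by positivity), sq]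
  exact mul_le_of_le_one_left (by positivity) (inv_le_one_of_one_le₀ (by nlinarith [sq_nonneg x]))

theorem memLp_two_mul_inv_one_add_sq :
    MemLp (fun x : ℝ => ((x * (1 + x ^ 2)⁻¹ : ℝ) : ℂ)) 2 volume := by
  refine memLp_two_of_norm_sq_le (Measurable.aestronglyMeasurable (by fun_prop)) fun x => ?_
  rw [Complex.norm_real, norm_eq_abs, sq_abs, mul_pow, sq (1 + x ^ 2)⁻¹, ← mul_assoc]
  refine mul_le_of_le_one_left (by positivity) ?_
  rw [← div_eq_mul_inv, div_le_one (by positivity)]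
  linarith

/-- If `(1 + x²) f ∈ L²` then `f` and `x f` are integrable. -/
theorem integrable_of_memLp_one_add_sq_mul {f : ℝ → ℂ}
    (h : MemLp (fun x : ℝ => ((1 + x ^ 2 : ℝ) : ℂ) * f x) 2 volume) :
    Integrable f ∧ Integrable (fun x : ℝ => (x : ℂ) * f x) := by
  have h0 : ∀ x : ℝ, ((1 + x ^ 2 : ℝ) : ℂ) ≠ 0 := fun x => by
    exact_mod_cast (by positivity : (1 + x ^ 2 : ℝ) ≠ 0)
  constructor
  · refine (memLp_two_inv_one_add_sq.integrable_mul h).congr (Eventually.of_forall fun x => ?_)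
    have := h0 x
    simp only [Pi.mul_apply, Complex.ofReal_inv]
    field_simp
  · refine (memLp_two_mul_inv_one_add_sq.integrable_mul h).congr (Eventually.of_forall fun x => ?_)
    have := h0 x
    simp only [Pi.mul_apply, Complex.ofReal_inv, Complex.ofReal_mul]
    field_simp

theorem eLpNorm_symbol_mul_fourier_le {s : ℝ} (f : L2R) {m : ℝ → ℂ} {C : ℝ}
    (hle : ∀ ξ, ‖m ξ‖ ≤ C * (1 + ξ ^ 2) ^ (s / 2)) :
    eLpNorm (fun ξ => m ξ * (𝓕 (toC f) : L2C) ξ) 2 volume ≤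
      ENNReal.ofReal C * sobolevNorm s f := by
  refine eLpNorm_le_mul_eLpNorm_of_ae_le_mul (Eventually.of_forall fun ξ => ?_) 2
  rw [norm_mul, norm_mul, Complex.norm_real, norm_of_nonneg (by positivity), ← mul_assoc]
  gcongr
  exact hle ξ

theorem memLp_symbol_mul_fourier {s : ℝ} {f : L2R} (h : sobolevNorm s f < ∞) {m : ℝ → ℂ}
    (hm : Measurable m) {C : ℝ}
    (hle : ∀ ξ, ‖m ξ‖ ≤ C * (1 + ξ ^ 2) ^ (s / 2)) :
    MemLp (fun ξ => m ξ * (𝓕 (toC f) : L2C) ξ) 2 volume :=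
  ⟨hm.aestronglyMeasurable.mul (Lp.aestronglyMeasurable _),
    (eLpNorm_symbol_mul_fourier_le f hle).trans_lt (ENNReal.mul_lt_top ENNReal.ofReal_lt_top h)⟩

theorem sobolevNorm_mono {s t : ℝ} (h : s ≤ t) (f : L2R) : sobolevNorm s f ≤ sobolevNorm t f := by
  refine (eLpNorm_symbol_mul_fourier_le (s := t) (C := 1) f
    (m := fun ξ : ℝ => (((1 + ξ ^ 2) ^ (s / 2) : ℝ) : ℂ)) fun ξ => ?_).trans (by simp)
  rw [Complex.norm_real, norm_of_nonneg (by positivity), one_mul]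
  exact rpow_le_rpow_of_exponent_le (by nlinarith [sq_nonneg ξ]) (by linarith)

theorem integrable_fourier {f : L2R} (h : sobolevNorm 2 f < ∞) :
    Integrable (𝓕 (toC f) : L2C) := by
  refine (integrable_of_memLp_one_add_sq_mul (memLp_symbol_mul_fourier h (C := 1) (by fun_prop)
    fun ξ => ?_)).1
  rw [Complex.norm_real, norm_of_nonneg (by positivity), one_mul]
  simp

/-- The embedding of `H²(ℝ)` in `L^∞(ℝ)`. -/
theorem exists_ae_bound :
    ∃ C : ℝ≥0∞, C ≠ ∞ ∧ ∀ f : L2R, sobolevNorm 2 f < ∞ →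
      ∀ᵐ x : ℝ, ‖f x‖ₑ ≤ C * sobolevNorm 2 f := by
  refine ⟨eLpNorm (fun x : ℝ => (((1 + x ^ 2)⁻¹ : ℝ) : ℂ)) 2 volume,
    memLp_two_inv_one_add_sq.2.ne, fun f hf => ?_⟩
  have hi := integrable_fourier hf
  have h1 : ∫⁻ ξ, ‖(𝓕 (toC f) : L2C) ξ‖ₑ ≤
      eLpNorm (fun x : ℝ => (((1 + x ^ 2)⁻¹ : ℝ) : ℂ)) 2 volume * sobolevNorm 2 f := by
    rw [← eLpNorm_one_eq_lintegral_enorm]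
    refine le_trans (le_of_eq ?_) (eLpNorm_smul_le_mul_eLpNorm (p := 2) (q := 2) (r := 1)
      (f := (fun ξ : ℝ => (((1 + ξ ^ 2) ^ ((2 : ℝ) / 2) : ℝ) : ℂ) * (𝓕 (toC f) : L2C) ξ))
      (φ := fun x : ℝ => (((1 + x ^ 2)⁻¹ : ℝ) : ℂ)) ?_ ?_)
    · congr 1
      ext ξ
      have : ((1 + ξ ^ 2 : ℝ) : ℂ) ≠ 0 := by exact_mod_cast (by positivity : (1 + ξ ^ 2 : ℝ) ≠ 0)
      simp only [Pi.smul_apply', smul_eq_mul, div_self (two_ne_zero (α := ℝ)), rpow_one,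
        Complex.ofReal_inv]
      field_simp
    · exact (Measurable.aestronglyMeasurable (by fun_prop)).mul (Lp.aestronglyMeasurable _)
    · exact memLp_two_inv_one_add_sq.1
  have h2 := fourierInv_ae_eq_of_integrable hi
  rw [FourierTransform.fourierInv_fourier_eq] at h2
  filter_upwards [h2, toC_coe f] with x hx hx2
  refine le_trans ?_ h1
  have e : ‖f x‖ₑ = ‖toC f x‖ₑ := by rw [hx2, ← ofReal_norm, ← ofReal_norm, Complex.norm_real]
  rw [e, hx, fourierInv_eq]
  refine (enorm_integral_le_lintegral_enorm _).trans (le_of_eq ?_)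
  refine lintegral_congr fun ξ => ?_
  rw [← ofReal_norm, ← ofReal_norm, Circle.norm_smul]

/-- Functions of `H⁴(ℝ)` are bounded and continuously differentiable. -/
theorem exists_hasDerivAt_representative {f : L2R} (h : sobolevNorm 4 f < ∞) :
    ∃ (U U' : ℝ → ℝ) (R : ℝ), (∀ x, HasDerivAt U (U' x) x) ∧ f =ᵐ[volume] U ∧ Continuous U' ∧
      MemLp U 2 volume ∧ MemLp U' 2 volume ∧ ∀ x, |U x| ≤ R := by
  set F : L2C := 𝓕 (toC f) with hF
  have hint := integrable_of_memLp_one_add_sq_mul (memLp_symbol_mul_fourier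
    ((sobolevNorm_mono (show (2 : ℝ) ≤ 4 by norm_num) f).trans_lt h)
    (m := fun ξ : ℝ => ((1 + ξ ^ 2 : ℝ) : ℂ)) (C := 1) (by fun_prop)
    fun ξ => by
      rw [Complex.norm_real, norm_of_nonneg (by positivity), one_mul]
      simp)
  rw [← hF] at hint
  have hd2 : MemLp (fun ξ : ℝ => (2 * π * Complex.I * ξ) * F ξ) 2 volume := by
    refine memLp_symbol_mul_fourier h (by fun_prop) (C := 2 * π) fun ξ => ?_
    have : (1 + ξ ^ 2 : ℝ) ^ ((4 : ℝ) / 2) = (1 + ξ ^ 2) ^ 2 := by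
      rw [show (4 : ℝ) / 2 = (2 : ℕ) by norm_num, rpow_natCast]
    rw [this]
    simp only [norm_mul, Complex.norm_real, Complex.norm_I, Complex.norm_ofNat, mul_one,
      norm_eq_abs, abs_of_pos pi_pos]
    gcongr
    exact abs_le.2 ⟨by nlinarith [sq_nonneg ξ, sq_nonneg (ξ + 1)],
      by nlinarith [sq_nonneg ξ, sq_nonneg (ξ - 1)]⟩
  have hd1 : Integrable (fun ξ : ℝ => (2 * π * Complex.I * ξ) * F ξ) :=
    (hint.2.const_mul (2 * π * Complex.I)).congr
      (Eventually.of_forall fun ξ => by simp only; ring)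
  have hinv : ∀ g : ℝ → ℂ, 𝓕⁻ g = fun x => 𝓕 g (-x) := fun g =>
    funext fun x => fourierInv_eq_fourier_neg _ _
  have hderiv : ∀ x, HasDerivAt (𝓕⁻ (F : ℝ → ℂ))
      (𝓕⁻ (fun ξ : ℝ => (2 * π * Complex.I * ξ) * F ξ) x) x := by
    intro x
    have h1 := hasDerivAt_fourier hint.1 (by simpa using hint.2) (-x)
    have h2 := h1.scomp x (hasDerivAt_neg x)
    rw [hinv, hinv]
    refine HasDerivAt.congr_deriv h2 ?_
    beta_reduce
    rw [fourier_real_eq, fourier_real_eq, neg_one_smul, ← integral_neg]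
    refine integral_congr_ae (Eventually.of_forall fun ξ => ?_)
    simp only [Circle.smul_def, smul_eq_mul]
    ring
  have hcont' : Continuous (𝓕⁻ (fun ξ : ℝ => (2 * π * Complex.I * ξ) * F ξ)) := by
    rw [hinv]
    exact (continuous_fourier_of_integrable hd1).comp continuous_neg
  have hfeq : ∀ᵐ x : ℝ, ((f x : ℝ) : ℂ) = 𝓕⁻ (F : ℝ → ℂ) x := by
    have h2 := fourierInv_ae_eq_of_integrable hint.1
    rw [hF, FourierTransform.fourierInv_fourier_eq] at h2
    filter_upwards [h2, toC_coe f] with x hx hx2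
    rw [← hx2, hx]
  have hU' : MemLp (𝓕⁻ (fun ξ : ℝ => (2 * π * Complex.I * ξ) * F ξ)) 2 volume := by
    set g : L2C := hd2.toLp _ with hg
    have hgc : g =ᵐ[volume] _ := hd2.coeFn_toLp
    have h2 := fourierInv_ae_eq_of_integrable (hd1.congr hgc.symm)
    refine (Lp.memLp (𝓕⁻ g)).ae_eq (h2.trans (Eventually.of_forall fun x => ?_))
    rw [fourierInv_eq, fourierInv_eq]
    exact integral_congr_ae (hgc.mono fun ξ hξ => by simp only [hξ])
  have hfU : f =ᵐ[volume] fun x => (𝓕⁻ (F : ℝ → ℂ) x).re :=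
    hfeq.mono fun x hx => by simp only [← hx, Complex.ofReal_re]
  refine ⟨fun x => (𝓕⁻ (F : ℝ → ℂ) x).re,
    fun x => (𝓕⁻ (fun ξ : ℝ => (2 * π * Complex.I * ξ) * F ξ) x).re,
    ∫ ξ, ‖F ξ‖, fun x => ?_, hfU, Complex.continuous_re.comp hcont', (Lp.memLp f).ae_eq hfU,
    hU'.re, fun x => ?_⟩
  · exact Complex.reCLM.hasFDerivAt.comp_hasDerivAt x (hderiv x)
  · refine (Complex.abs_re_le_norm _).trans ?_
    rw [fourierInv_eq]
    refine (norm_integral_le_integral_norm _).trans (le_of_eq ?_)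
    simp

theorem memLp_weight {f : L2R} (h : weightNorm 2 f < ∞) :
    MemLp (fun x : ℝ => ((1 + x ^ 2 : ℝ) : ℂ) * toC f x) 2 volume := by
  have h2 : MemLp (fun x : ℝ => |x| ^ 2 * f x) 2 volume :=
    ⟨(Measurable.aestronglyMeasurable (by fun_prop)).mul (Lp.aestronglyMeasurable f), h⟩
  refine (((Lp.memLp f).add h2).ofReal (K := ℂ)).ae_eq ?_
  filter_upwards [toC_coe f] with x hx
  simp only [Pi.add_apply, hx, sq_abs]
  push_cast
  simp
  ring

theorem memLp_mul_of_weight {f : L2R} (h : weightNorm 2 f < ∞) :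
    MemLp (fun x : ℝ => (x : ℂ) * toC f x) 2 volume := by
  refine (memLp_weight h).mono ((Measurable.aestronglyMeasurable (by fun_prop)).mul
    (Lp.aestronglyMeasurable _)) (Eventually.of_forall fun x => ?_)
  rw [norm_mul, norm_mul, Complex.norm_real, Complex.norm_real]
  gcongr
  rw [norm_of_nonneg (by positivity : 0 ≤ 1 + x ^ 2)]
  exact abs_le.2 ⟨by nlinarith [sq_nonneg x, sq_nonneg (x + 1)],
      by nlinarith [sq_nonneg x, sq_nonneg (x - 1)]⟩

theorem memLp_mul_of_weight_one {f : L2R} (h : weightNorm 1 f < ∞) :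
    MemLp (fun x : ℝ => (x : ℂ) * toC f x) 2 volume := by
  refine ⟨(Measurable.aestronglyMeasurable (by fun_prop)).mul
    (Lp.aestronglyMeasurable _), lt_of_le_of_lt (le_of_eq ?_) h⟩
  refine eLpNorm_congr_norm_ae ?_
  filter_upwards [toC_coe f] with x hx
  simp [hx]

/-! ### The mass, energy and virial identities -/

/-- A nonlinearity `g` with `g(0) = 0`, its derivative `g'`, its primitive `G`, and the primitive
`K` of `s g'(s)`. -/
structure Nonlinearity (g g' G K : ℝ → ℝ) : Prop where
  hasDerivAt : ∀ s, HasDerivAt g (g' s) s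
  continuous_deriv : Continuous g'
  hasDerivAt_G : ∀ s, HasDerivAt G (g s) s
  hasDerivAt_K : ∀ s, HasDerivAt K (s * g' s) s
  map_zero : g 0 = 0
  G_zero : G 0 = 0
  K_zero : K 0 = 0

theorem exists_linear_bound {f f' : ℝ → ℝ} (hf : ∀ s, HasDerivAt f (f' s) s)
    (hf' : Continuous f') (h0 : f 0 = 0) (R : ℝ) :
    ∃ C, 0 ≤ C ∧ ∀ s, |s| ≤ R → |f s| ≤ C * |s| := by
  obtain ⟨C, hC⟩ := (isCompact_Icc (a := -R) (b := R)).exists_bound_of_continuousOn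
    hf'.continuousOn
  refine ⟨max C 0, le_max_right _ _, fun s hs => ?_⟩
  have h := Convex.norm_image_sub_le_of_norm_hasDerivWithin_le (f := f) (f' := f')
    (s := Set.Icc (-R) R) (C := max C 0) (x := 0) (y := s)
    (fun x _ => (hf x).hasDerivWithinAt) (fun x hx => (hC x hx).trans (le_max_left _ _))
    (convex_Icc _ _) (abs_le.1 (by simpa using (abs_nonneg s).trans hs)) (abs_le.1 hs)
  simpa [h0] using h

theorem exists_quadratic_bound {f f' : ℝ → ℝ} (hf : ∀ s, HasDerivAt f (f' s) s)
    (h0 : f 0 = 0) {R C : ℝ} (hC : ∀ s, |s| ≤ R → |f' s| ≤ C * |s|) (hC0 : 0 ≤ C) :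
    ∀ s, |s| ≤ R → |f s| ≤ C * s ^ 2 := by
  intro s hs
  have h := Convex.norm_image_sub_le_of_norm_hasDerivWithin_le (f := f) (f' := f')
    (s := Set.Icc (-|s|) |s|) (C := C * |s|) (x := 0) (y := s)
    (fun x _ => (hf x).hasDerivWithinAt) (fun x hx => by
      have hx' : |x| ≤ |s| := abs_le.2 hx
      exact (hC x (hx'.trans hs)).trans (by gcongr))
    (convex_Icc _ _) (abs_le.1 (by simp)) (abs_le.1 le_rfl)
  simp only [h0, sub_zero, norm_eq_abs] at h
  rwa [mul_assoc, abs_mul_abs_self, ← sq] at h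

theorem Nonlinearity.exists_bounds {g g' G K : ℝ → ℝ} (hN : Nonlinearity g g' G K) (R : ℝ) :
    ∃ C, 0 ≤ C ∧ ∀ s, |s| ≤ R → |g s| ≤ C * |s| ∧ |s * g' s| ≤ C * |s| ∧ |g' s| ≤ C ∧
      |G s| ≤ C * s ^ 2 ∧ |K s| ≤ C * s ^ 2 := by
  obtain ⟨C₁, hC₁, h₁⟩ := exists_linear_bound hN.hasDerivAt hN.continuous_deriv hN.map_zero R
  obtain ⟨C₂, hC₂⟩ := (isCompact_Icc (a := -R) (b := R)).exists_bound_of_continuousOn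
    hN.continuous_deriv.continuousOn
  have e1 : C₁ ≤ max C₁ C₂ := le_max_left _ _
  have e2 : C₂ ≤ max C₁ C₂ := le_max_right _ _
  have hg' : ∀ s, |s| ≤ R → |g' s| ≤ max C₁ C₂ := fun s hs => (hC₂ s (abs_le.1 hs)).trans e2
  have hsg' : ∀ s, |s| ≤ R → |s * g' s| ≤ max C₁ C₂ * |s| := fun s hs => by
    rw [abs_mul, mul_comm]; gcongr; exact hg' s hs
  have hg : ∀ s, |s| ≤ R → |g s| ≤ max C₁ C₂ * |s| := fun s hs => (h₁ s hs).trans (by gcongr)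
  exact ⟨max C₁ C₂, hC₁.trans e1, fun s hs => ⟨hg s hs, hsg' s hs, hg' s hs,
    exists_quadratic_bound hN.hasDerivAt_G hN.G_zero hg (hC₁.trans e1) s hs,
    exists_quadratic_bound hN.hasDerivAt_K hN.K_zero hsg' (hC₁.trans e1) s hs⟩⟩

theorem re_inner_integrable (f g : L2C) :
    Integrable (fun x => (f x).re * (g x).re + (f x).im * (g x).im) := by
  have h := (L2.integrable_inner (𝕜 := ℂ) f g).re
  refine h.congr (Eventually.of_forall fun x => ?_)
  simp [RCLike.inner_apply]
  ring

theorem re_inner_eq (f g : L2C) :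
    (inner ℂ f g : ℂ).re = ∫ x, ((f x).re * (g x).re + (f x).im * (g x).im) := by
  rw [L2.inner_def]
  have h := integral_re (L2.integrable_inner (𝕜 := ℂ) f g)
  simp only [RCLike.re_to_complex] at h
  rw [← h]
  refine integral_congr_ae (Eventually.of_forall fun x => ?_)
  simp [RCLike.inner_apply]
  ring

theorem re_inner_fourier (f g : L2C) :
    (inner ℂ (𝓕 f : L2C) (𝓕 g : L2C) : ℂ).re = (inner ℂ f g : ℂ).re := by
  rw [Lp.inner_fourier_eq]

theorem re_inner_self (f : L2C) : (inner ℂ f f : ℂ).re = ‖f‖ ^ 2 :=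
  inner_self_eq_norm_sq (𝕜 := ℂ) f

/-- An operator with purely imaginary symbol is antisymmetric. -/
theorem re_inner_eq_zero_of_fourier {f g : L2C} {m : ℝ → ℝ}
    (h : ∀ᵐ ξ : ℝ, (𝓕 g : L2C) ξ = Complex.I * m ξ * (𝓕 f : L2C) ξ) :
    (inner ℂ f g : ℂ).re = 0 := by
  rw [← re_inner_fourier, re_inner_eq, integral_eq_zero_of_ae]
  filter_upwards [h] with ξ hξ
  simp only [hξ, Pi.zero_apply, Complex.mul_re, Complex.mul_im, Complex.I_re, Complex.I_im,
    Complex.ofReal_re, Complex.ofReal_im]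
  ring

theorem fourier_add_L2 (f g : L2C) : 𝓕 (f + g) = 𝓕 f + 𝓕 g :=
  (Lp.fourierTransformₗᵢ ℝ ℂ).map_add f g

/-- `F₁ = ∂ₓ (g(u))` is given by the chain rule. -/
theorem deriv_nonlinear_ae_eq {g g' G K : ℝ → ℝ} (hN : Nonlinearity g g' G K) {u : L2R}
    {U U' : ℝ → ℝ} {R : ℝ} (hU : ∀ x, HasDerivAt U (U' x) x) (huU : u =ᵐ[volume] U)
    (hU'c : Continuous U') (hU' : MemLp U' 2 volume) (hR : ∀ x, |U x| ≤ R) {F F₁ : L2C}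
    (hF : ∀ᵐ x : ℝ, F x = ((g (u x) : ℝ) : ℂ)) (hF₁ : IsDeriv F F₁) :
    F₁ =ᵐ[volume] fun x => ((g' (U x) * U' x : ℝ) : ℂ) := by
  have hUc : Continuous U := continuous_iff_continuousAt.2 fun x => (hU x).continuousAt
  obtain ⟨C, hC0, hC⟩ := hN.exists_bounds R
  refine hF₁.ae_eq_of_hasDerivAt (φ := fun x => ((g (U x) : ℝ) : ℂ))
    (fun x => ((hN.hasDerivAt (U x)).comp x (hU x)).ofReal_comp) ?_ ?_
  · refine MemLp.ofReal (K := ℂ) ?_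
    refine hU'.of_le_mul (c := C) (((hN.continuous_deriv.comp hUc).mul hU'c).aestronglyMeasurable)
      (Eventually.of_forall fun x => ?_)
    change ‖g' (U x) * U' x‖ ≤ C * ‖U' x‖
    rw [norm_mul]
    gcongr
    exact (hC _ (hR x)).2.2.1
  · filter_upwards [hF, huU] with x h1 h2
    rw [h1, h2]

theorem fourier_hilbert_deriv_two {f w₁ w₂ : L2C} (h₁ : IsDeriv f w₁) (h₂ : IsDeriv w₁ w₂) :
    ∀ᵐ ξ : ℝ, (𝓕 (hilbertTransform w₂) : L2C) ξ =
      Complex.I * ((4 * π ^ 2 * (ξ * |ξ|) : ℝ) : ℂ) * (𝓕 f : L2C) ξ := by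
  filter_upwards [hilbertTransform_fourier w₂, h₁.fourier, h₂.fourier] with ξ e1 e2 e3
  rw [e1, e3, e2, hilbertSymbol]
  have : (|ξ| : ℝ) = (SignType.sign ξ : ℝ) * ξ := by simp
  rw [this]
  push_cast
  linear_combination (-4 * π ^ 2 * (SignType.sign ξ : ℝ) * ξ ^ 2 * (𝓕 f : L2C) ξ * Complex.I) *
    Complex.I_sq

theorem fourier_hilbert_deriv {f w₁ : L2C} (h₁ : IsDeriv f w₁) :
    ∀ᵐ ξ : ℝ, (𝓕 (hilbertTransform w₁) : L2C) ξ =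
      ((2 * π * |ξ| : ℝ) : ℂ) * (𝓕 f : L2C) ξ := by
  filter_upwards [hilbertTransform_fourier w₁, h₁.fourier] with ξ e1 e2
  rw [e1, e2, hilbertSymbol]
  have : (|ξ| : ℝ) = (SignType.sign ξ : ℝ) * ξ := by simp
  rw [this]
  push_cast
  linear_combination (-2 * π * (SignType.sign ξ : ℝ) * ξ * (𝓕 f : L2C) ξ) * Complex.I_sq

theorem toC_ae_eq {u : L2R} {U : ℝ → ℝ} (huU : u =ᵐ[volume] U) :
    ∀ᵐ x : ℝ, toC u x = (U x : ℂ) := by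
  filter_upwards [toC_coe u, huU] with x h1 h2
  rw [h1, h2]

/-- Conservation of mass: `∂ₜ u` is orthogonal to `u`. -/
theorem mass_identity {g g' G K : ℝ → ℝ} (hN : Nonlinearity g g' G K) {u v : L2R}
    (hu : sobolevNorm 4 u < ∞) (he : Equation g u v) : (inner ℂ (toC u) (toC v) : ℂ).re = 0 := by
  obtain ⟨w₁, w₂, F, F₁, h₁, h₂, hF, hF₁, heq⟩ := he
  obtain ⟨U, U', R, hU, huU, hU'c, hU2, hU'2, hR⟩ := exists_hasDerivAt_representative hu
  have hUc : Continuous U := continuous_iff_continuousAt.2 fun x => (hU x).continuousAt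
  obtain ⟨C, hC0, hC⟩ := hN.exists_bounds R
  have hv : toC v = -(hilbertTransform w₂ + F₁) := by
    rw [eq_neg_iff_add_eq_zero, ← add_assoc, heq]
  have e1 : (inner ℂ (toC u) (hilbertTransform w₂) : ℂ).re = 0 :=
    re_inner_eq_zero_of_fourier (fourier_hilbert_deriv_two h₁ h₂)
  have e2 : (inner ℂ (toC u) F₁ : ℂ).re = ∫ x, U x * g' (U x) * U' x := by
    rw [re_inner_eq]
    refine integral_congr_ae ?_
    filter_upwards [toC_ae_eq huU, deriv_nonlinear_ae_eq hN hU huU hU'c hU'2 hR hF hF₁]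
      with x hx1 hx2
    simp only [hx1, hx2, Complex.ofReal_re, Complex.ofReal_im]
    ring
  have e3 : ∫ x, U x * g' (U x) * U' x = 0 := by
    refine integral_eq_zero_of_hasDerivAt_of_integrable (f := fun x => K (U x))
      (fun x => (hN.hasDerivAt_K (U x)).comp x (hU x)) ?_ ?_
    · refine (hU2.integrable_mul hU'2).norm.const_mul C |>.mono'
        (((hUc.mul (hN.continuous_deriv.comp hUc)).mul hU'c).aestronglyMeasurable)
        (Eventually.of_forall fun x => ?_)
      simp only [Pi.mul_apply, norm_eq_abs]
      rw [abs_mul, abs_mul (U x) (U' x), ← mul_assoc]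
      gcongr
      exact (hC _ (hR x)).2.1
    · have hKc : Continuous K := continuous_iff_continuousAt.2 fun x =>
        (hN.hasDerivAt_K x).continuousAt
      refine (hU2.integrable_sq.const_mul C).mono' (hKc.comp hUc).aestronglyMeasurable
        (Eventually.of_forall fun x => ?_)
      exact (hC _ (hR x)).2.2.2.2
  rw [hv, inner_neg_right, inner_add_right, Complex.neg_re, Complex.add_re, e1, e2, e3]
  simp

/-- Conservation of energy: `∂ₜ u = -∂ₓ W` is orthogonal to `W = H ∂ₓ u + g(u)`, the variational
derivative of the energy. -/
theorem energy_identity {g : ℝ → ℝ} {u v : L2R} (he : Equation g u v) {a b : L2C}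
    (ha : ∀ᵐ ξ : ℝ, a ξ = ((√|ξ| : ℝ) : ℂ) * (𝓕 (toC u) : L2C) ξ)
    (hb : ∀ᵐ ξ : ℝ, b ξ = ((√|ξ| : ℝ) : ℂ) * (𝓕 (toC v) : L2C) ξ) :
    2 * π * (inner ℂ a b : ℂ).re + ∫ x, g (u x) * v x = 0 := by
  obtain ⟨w₁, w₂, F, F₁, h₁, h₂, hF, hF₁, heq⟩ := he
  have hv : toC v = -(hilbertTransform w₂ + F₁) := by
    rw [eq_neg_iff_add_eq_zero, ← add_assoc, heq]
  have hW : (inner ℂ (hilbertTransform w₁ + F) (hilbertTransform w₂ + F₁) : ℂ).re = 0 := by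
    refine re_inner_eq_zero_of_fourier (m := fun ξ => 2 * π * ξ) ?_
    rw [fourier_add_L2, fourier_add_L2]
    filter_upwards [Lp.coeFn_add (𝓕 (hilbertTransform w₂) : L2C) (𝓕 F₁),
      Lp.coeFn_add (𝓕 (hilbertTransform w₁) : L2C) (𝓕 F), hF₁.fourier, h₂.fourier,
      hilbertTransform_fourier w₁, hilbertTransform_fourier w₂] with ξ k1 k2 k3 k4 k5 k6
    rw [k1, k2, Pi.add_apply, Pi.add_apply, k3, k6, k4, k5]
    push_cast
    ring
  have e1 : (inner ℂ (hilbertTransform w₁) (toC v) : ℂ).re = 2 * π * (inner ℂ a b : ℂ).re := by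
    rw [← re_inner_fourier, re_inner_eq, re_inner_eq, ← integral_const_mul]
    refine integral_congr_ae ?_
    filter_upwards [ha, hb, fourier_hilbert_deriv h₁] with ξ k1 k2 k3
    rw [k1, k2, k3]
    simp only [Complex.mul_re, Complex.mul_im, Complex.ofReal_re, Complex.ofReal_im]
    have := mul_self_sqrt (abs_nonneg ξ)
    linear_combination (-(2 * π) * (((𝓕 (toC u) : L2C) ξ).re * ((𝓕 (toC v) : L2C) ξ).re +
      ((𝓕 (toC u) : L2C) ξ).im * ((𝓕 (toC v) : L2C) ξ).im)) * this
  have e2 : (inner ℂ F (toC v) : ℂ).re = ∫ x, g (u x) * v x := by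
    rw [re_inner_eq]
    refine integral_congr_ae ?_
    filter_upwards [hF, toC_coe v] with x k1 k2
    simp only [k1, k2, Complex.ofReal_re, Complex.ofReal_im]
    ring
  rw [← e1, ← e2, ← Complex.add_re, ← inner_add_left, hv, inner_neg_right, Complex.neg_re, hW,
    neg_zero]

theorem hasDerivAt_mul_abs (x : ℝ) : HasDerivAt (fun y : ℝ => y * |y|) (2 * |x|) x := by
  rcases lt_trichotomy x 0 with h | h | h
  · have := ((hasDerivAt_id x).mul (hasDerivAt_abs_neg h))
    refine this.congr_deriv ?_
    simp [abs_of_neg h]; ring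
  · subst h
    rw [hasDerivAt_iff_tendsto_slope_zero]
    have : Tendsto (fun t : ℝ => |t|) (𝓝[≠] 0) (𝓝 0) := by
      have h := continuous_abs.tendsto (0 : ℝ)
      rw [abs_zero] at h
      exact h.mono_left nhdsWithin_le_nhds
    simp only [abs_zero, mul_zero, zero_add, sub_zero, smul_eq_mul]
    refine this.congr' ?_
    filter_upwards [self_mem_nhdsWithin] with t ht
    have : t ≠ 0 := ht
    field_simp
  · have := ((hasDerivAt_id x).mul (hasDerivAt_abs_pos h))
    refine this.congr_deriv ?_
    simp [abs_of_pos h]; ring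

/-- The dispersive part of the virial identity, `-∫ x u H ∂ₓ² u = 2π ∫ |ξ| |û|²`: on the Fourier
side it is an integration by parts of `ξ|ξ| ∂_ξ |û|²`. -/
theorem re_inner_mul_hilbert_deriv_two {u : L2R} (hu : normX 4 2 u < ∞) {w₁ w₂ y a : L2C}
    (h₁ : IsDeriv (toC u) w₁) (h₂ : IsDeriv w₁ w₂) (hy : ∀ᵐ x : ℝ, y x = x * toC u x)
    (ha : ∀ᵐ ξ : ℝ, a ξ = ((√|ξ| : ℝ) : ℂ) * (𝓕 (toC u) : L2C) ξ) :
    (inner ℂ y (hilbertTransform w₂) : ℂ).re = -(2 * π * ‖a‖ ^ 2) := by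
  have hs : sobolevNorm 4 u < ∞ := lt_of_le_of_lt le_self_add hu
  have hw : weightNorm 2 u < ∞ := lt_of_le_of_lt le_add_self hu
  obtain ⟨hi0, hi1⟩ := integrable_of_memLp_one_add_sq_mul (memLp_weight hw)
  have hyi : Integrable y := hi1.congr (hy.mono fun x hx => hx.symm)
  set φ : ℝ → ℂ := 𝓕 (toC u : ℝ → ℂ) with hφ
  set φ' : ℝ → ℂ := 𝓕 (fun x : ℝ => (-2 * π * Complex.I * x) • toC u x) with hφ'
  have hd : ∀ ξ, HasDerivAt φ (φ' ξ) ξ := hasDerivAt_fourier hi0 (by simpa using hi1)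
  have hφc : Continuous φ := continuous_iff_continuousAt.2 fun x => (hd x).continuousAt
  have hyφ : ∀ᵐ ξ : ℝ, (𝓕 y : L2C) ξ = Complex.I / (2 * π) * φ' ξ := by
    filter_upwards [fourier_ae_eq_of_integrable hyi] with ξ hξ
    rw [hξ, hφ', fourier_real_eq, fourier_real_eq, ← integral_const_mul]
    refine integral_congr_ae (hy.mono fun x hx => ?_)
    have hpi : (π : ℂ) ≠ 0 := by exact_mod_cast pi_ne_zero
    simp only [hx, Circle.smul_def, smul_eq_mul]
    field_simp
    linear_combination ((x : ℂ) * toC u x) * Complex.I_sq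
  have huφ := fourier_ae_eq_of_integrable hi0
  have hξφ : MemLp (fun ξ : ℝ => (ξ : ℂ) * φ ξ) 2 volume := by
    have := memLp_symbol_mul_fourier hs (m := fun ξ : ℝ => (ξ : ℂ)) (C := 1) (by fun_prop)
      fun ξ => by
        rw [show (4 : ℝ) / 2 = (2 : ℕ) by norm_num, rpow_natCast, one_mul, Complex.norm_real]
        exact abs_le.2 ⟨by nlinarith [sq_nonneg ξ, sq_nonneg (ξ + 1), sq_nonneg (ξ ^ 2)],
          by nlinarith [sq_nonneg ξ, sq_nonneg (ξ - 1), sq_nonneg (ξ ^ 2)]⟩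
    exact this.ae_eq (huφ.mono fun ξ hξ => by simp only [hξ, hφ])
  -- the derivative of `ξ|ξ| |φ|²`
  set D : ℝ → ℝ := fun ξ => 2 * |ξ| * ((φ ξ).re ^ 2 + (φ ξ).im ^ 2) +
    ξ * |ξ| * (2 * (φ ξ).re * (φ' ξ).re + 2 * (φ ξ).im * (φ' ξ).im) with hD
  have hpt : ∀ᵐ ξ : ℝ, ((𝓕 y : L2C) ξ).re * ((𝓕 (hilbertTransform w₂) : L2C) ξ).re +
      ((𝓕 y : L2C) ξ).im * ((𝓕 (hilbertTransform w₂) : L2C) ξ).im =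
      π * D ξ - 2 * π * ((a ξ).re * (a ξ).re + (a ξ).im * (a ξ).im) := by
    filter_upwards [hyφ, fourier_hilbert_deriv_two h₁ h₂, ha, huφ] with ξ k1 k2 k3 k4
    have e : Complex.I / (2 * π) * φ' ξ = Complex.I * ((1 / (2 * π) : ℝ) : ℂ) * φ' ξ := by
      push_cast; ring
    rw [k1, k2, k3, k4, e, hD]
    simp only [Complex.mul_re, Complex.mul_im, Complex.ofReal_re, Complex.ofReal_im,
      Complex.I_re, Complex.I_im]
    have hsq := mul_self_sqrt (abs_nonneg ξ)
    have hc : 1 / (2 * π) * π = 1 / 2 := by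
      have hpi := pi_ne_zero
      field_simp
    rw [← hφ]
    linear_combination (4 * π * (ξ * |ξ|) * ((φ' ξ).im * (φ ξ).im + (φ' ξ).re * (φ ξ).re)) * hc +
      (2 * π * ((φ ξ).re ^ 2 + (φ ξ).im ^ 2)) * hsq
  have hi2 := re_inner_integrable (𝓕 y) (𝓕 (hilbertTransform w₂))
  have hi3 := re_inner_integrable a a
  have hDi : Integrable D := by
    refine ((hi2.add (hi3.const_mul (2 * π))).const_mul π⁻¹).congr (hpt.mono fun ξ hξ => ?_)
    have hpi := pi_ne_zero
    simp only [Pi.add_apply, hξ]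
    field_simp
    ring
  have hD0 : ∫ ξ, D ξ = 0 := by
    refine integral_eq_zero_of_hasDerivAt_of_integrable
      (f := fun ξ => ξ * |ξ| * ((φ ξ).re ^ 2 + (φ ξ).im ^ 2)) (fun ξ => ?_) hDi ?_
    · have hr : HasDerivAt (fun ξ => (φ ξ).re) (φ' ξ).re ξ :=
        Complex.reCLM.hasFDerivAt.comp_hasDerivAt ξ (hd ξ)
      have hm : HasDerivAt (fun ξ => (φ ξ).im) (φ' ξ).im ξ :=
        Complex.imCLM.hasFDerivAt.comp_hasDerivAt ξ (hd ξ)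
      refine ((hasDerivAt_mul_abs ξ).mul ((hr.pow 2).add (hm.pow 2))).congr_deriv ?_
      simp only [hD, Pi.add_apply, Pi.pow_apply]
      norm_num
    · refine (hξφ.norm.integrable_sq).mono' (Continuous.aestronglyMeasurable (by fun_prop))
        (Eventually.of_forall fun ξ => ?_)
      rw [norm_mul, norm_mul, norm_mul, mul_pow, Complex.norm_real, ← Complex.normSq_eq_norm_sq,
        Complex.normSq_apply, norm_eq_abs ξ, norm_eq_abs |ξ|, abs_abs,
        norm_of_nonneg (by positivity)]
      apply le_of_eq
      ring
  rw [← re_inner_fourier, re_inner_eq, integral_congr_ae hpt,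
    integral_sub (hDi.const_mul _) (hi3.const_mul _), integral_const_mul, integral_const_mul, hD0,
    ← re_inner_eq, re_inner_self]
  ring

/-- The virial identity: the rate of change of `½ ∫ x u²` is `‖D^{1/2} u‖₂² + ∫ K(u)`. -/
theorem virial_identity {g g' G K : ℝ → ℝ} (hN : Nonlinearity g g' G K) {u v : L2R}
    (hu : normX 4 2 u < ∞) (he : Equation g u v) {y a : L2C}
    (hy : ∀ᵐ x : ℝ, y x = x * toC u x)
    (ha : ∀ᵐ ξ : ℝ, a ξ = ((√|ξ| : ℝ) : ℂ) * (𝓕 (toC u) : L2C) ξ) :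
    (inner ℂ y (toC v) : ℂ).re = 2 * π * ‖a‖ ^ 2 + ∫ x, K (u x) := by
  obtain ⟨w₁, w₂, F, F₁, h₁, h₂, hF, hF₁, heq⟩ := he
  obtain ⟨U, U', R, hU, huU, hU'c, hU2, hU'2, hR⟩ :=
    exists_hasDerivAt_representative (lt_of_le_of_lt le_self_add hu)
  have hUc : Continuous U := continuous_iff_continuousAt.2 fun x => (hU x).continuousAt
  obtain ⟨C, hC0, hC⟩ := hN.exists_bounds R
  have hv : toC v = -(hilbertTransform w₂ + F₁) := by
    rw [eq_neg_iff_add_eq_zero, ← add_assoc, heq]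
  have hKc : Continuous K := continuous_iff_continuousAt.2 fun x =>
    (hN.hasDerivAt_K x).continuousAt
  have hg'c := hN.continuous_deriv
  have hyU : ∀ᵐ x : ℝ, y x = ((x * U x : ℝ) : ℂ) := by
    filter_upwards [hy, toC_ae_eq huU] with x k1 k2
    rw [k1, k2]; push_cast; ring
  have hxU : MemLp (fun x => x * U x) 2 volume := by
    refine ((Lp.memLp y).re).ae_eq (hyU.mono fun x hx => ?_)
    simp [hx]
  have hKi : Integrable (fun x => K (U x)) := by
    refine (hU2.integrable_sq.const_mul C).mono' (hKc.comp hUc).aestronglyMeasurable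
        (Eventually.of_forall fun x => ?_)
    exact (hC _ (hR x)).2.2.2.2
  have hxi : Integrable (fun x => x * (U x * g' (U x) * U' x)) := by
    refine ((hxU.integrable_mul hU'2).norm.const_mul C).mono'
      (Continuous.aestronglyMeasurable (by fun_prop)) (Eventually.of_forall fun x => ?_)
    simp only [Pi.mul_apply, norm_eq_abs, abs_mul]
    have := (hC _ (hR x)).2.2.1
    calc |x| * (|U x| * |g' (U x)| * |U' x|) = |g' (U x)| * (|x| * |U x| * |U' x|) := by ring
      _ ≤ _ := by gcongr
  have e2 : (inner ℂ y F₁ : ℂ).re = ∫ x, x * (U x * g' (U x) * U' x) := by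
    rw [re_inner_eq]
    refine integral_congr_ae ?_
    filter_upwards [hyU, deriv_nonlinear_ae_eq hN hU huU hU'c hU'2 hR hF hF₁] with x hx1 hx2
    simp only [hx1, hx2, Complex.ofReal_re, Complex.ofReal_im]
    ring
  have e3 : ∫ x, x * (U x * g' (U x) * U' x) = -∫ x, K (U x) := by
    rw [integral_mul_deriv_eq_deriv_mul_of_integrable (u := fun x => x) (u' := fun _ => 1)
      (v := fun x => K (U x)) (fun x _ => hasDerivAt_id x)
      (fun x _ => (hN.hasDerivAt_K (U x)).comp x (hU x)) hxi ?_ ?_]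
    · simp
    · exact hKi.congr (Eventually.of_forall fun x => by simp)
    · refine ((hxU.integrable_mul hU2).norm.const_mul C).mono'
        (Continuous.aestronglyMeasurable (by fun_prop)) (Eventually.of_forall fun x => ?_)
      simp only [Pi.mul_apply, norm_eq_abs, abs_mul]
      have := (hC _ (hR x)).2.2.2.2
      calc |x| * |K (U x)| ≤ |x| * (C * U x ^ 2) := by gcongr
        _ = _ := by rw [← sq_abs (U x)]; ring
  have e4 : ∫ x, K (u x) = ∫ x, K (U x) :=
    integral_congr_ae (huU.mono fun x hx => by simp only [hx])
  rw [hv, inner_neg_right, inner_add_right, Complex.neg_re, Complex.add_re, e2, e3, e4,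
    re_inner_mul_hilbert_deriv_two hu h₁ h₂ hy ha]
  ring

/-! ### Differentiation in time -/

/-- If `L` is an operator of the form `w ↦ m · f(w)`, with `f` linear, which is bounded on the space
of norm `normX 2 1`, then `L(u)` is differentiable in `L²` with derivative `L(v)`. -/
theorem HasDerivIntoX.hasDerivAt_mul {u v : ℝ → L2R} (hd : HasDerivIntoX 2 1 u v)
    {f : L2R → L2C} (hsub : ∀ w z, f (w - z) = f w - f z) (hsmul : ∀ (c : ℝ) w, f (c • w) = c • f w)
    {m : ℝ → ℂ} (hb : ∀ w, eLpNorm (fun x => m x * f w x) 2 volume ≤ normX 2 1 w)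
    {y z : ℝ → L2C} (hy : ∀ t, ∀ᵐ x : ℝ, y t x = m x * f (u t) x)
    (hz : ∀ t, ∀ᵐ x : ℝ, z t x = m x * f (v t) x) (t : ℝ) : HasDerivAt y (z t) t := by
  rw [hasDerivAt_iff_tendsto_slope_zero, tendsto_iff_norm_sub_tendsto_zero]
  have h0 := (hd t).2.2
  have hle : ∀ h : ℝ, ‖h⁻¹ • (y (t + h) - y t) - z t‖ₑ ≤
      normX 2 1 (h⁻¹ • (u (t + h) - u t) - v t) := by
    intro h
    refine le_trans (le_of_eq ?_) (hb _)
    rw [Lp.enorm_def]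
    refine eLpNorm_congr_ae ?_
    rw [hsub, hsmul, hsub]
    filter_upwards [hy (t + h), hy t, hz t, Lp.coeFn_sub (h⁻¹ • (y (t + h) - y t)) (z t),
      Lp.coeFn_smul h⁻¹ (y (t + h) - y t), Lp.coeFn_sub (y (t + h)) (y t),
      Lp.coeFn_sub (h⁻¹ • (f (u (t + h)) - f (u t))) (f (v t)),
      Lp.coeFn_smul h⁻¹ (f (u (t + h)) - f (u t)), Lp.coeFn_sub (f (u (t + h))) (f (u t))]
      with x e1 e2 e3 e4 e5 e6 e7 e8 e9
    rw [e4, Pi.sub_apply, e5, Pi.smul_apply, e6, Pi.sub_apply, e7, Pi.sub_apply, e8, Pi.smul_apply,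
      e9, Pi.sub_apply, e1, e2, e3, Complex.real_smul, Complex.real_smul]
    ring
  have h1 : Tendsto (fun h : ℝ => ‖h⁻¹ • (y (t + h) - y t) - z t‖ₑ) (𝓝[≠] 0) (𝓝 0) :=
    tendsto_of_tendsto_of_tendsto_of_le_of_le tendsto_const_nhds h0 (fun _ => zero_le) hle
  have h2 := (ENNReal.tendsto_toReal ENNReal.zero_ne_top).comp h1
  simpa [Function.comp_def] using h2

theorem eLpNorm_toC_le (w : L2R) : eLpNorm (fun x => 1 * toC w x) 2 volume ≤ normX 2 1 w := by
  refine le_trans ?_ (le_self_add (a := sobolevNorm 2 w))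
  have h := eLpNorm_symbol_mul_fourier_le (s := 2) (C := 1) w (m := fun _ => 1) fun ξ => by
    rw [norm_one, one_mul, div_self two_ne_zero, rpow_one]
    nlinarith [sq_nonneg ξ]
  simp only [one_mul, ENNReal.ofReal_one] at h ⊢
  refine le_trans (le_of_eq ?_) h
  rw [← Lp.enorm_def, ← Lp.enorm_def, ← ofReal_norm, ← ofReal_norm, Lp.norm_fourier_eq]

theorem eLpNorm_mul_toC_le (w : L2R) :
    eLpNorm (fun x : ℝ => (x : ℂ) * toC w x) 2 volume ≤ normX 2 1 w := by
  refine le_trans (le_of_eq ?_) (le_add_self (b := sobolevNorm 2 w))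
  refine eLpNorm_congr_norm_ae ?_
  filter_upwards [toC_coe w] with x hx
  simp [hx]

theorem norm_sqrt_abs_le {s : ℝ} (hs : 1 / 2 ≤ s) (ξ : ℝ) :
    ‖((√|ξ| : ℝ) : ℂ)‖ ≤ 1 * (1 + ξ ^ 2) ^ (s / 2) := by
  rw [Complex.norm_real, norm_of_nonneg (sqrt_nonneg _), one_mul]
  have h1 : (1 : ℝ) ≤ 1 + ξ ^ 2 := by nlinarith [sq_nonneg ξ]
  calc √|ξ| = (ξ ^ 2) ^ (1 / 4 : ℝ) := by
        rw [← sq_abs, ← rpow_natCast, ← rpow_mul (abs_nonneg _), sqrt_eq_rpow]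
        norm_num
    _ ≤ (1 + ξ ^ 2) ^ (1 / 4 : ℝ) := by gcongr; linarith
    _ ≤ _ := rpow_le_rpow_of_exponent_le h1 (by linarith)

theorem eLpNorm_sqrt_mul_fourier_le (w : L2R) :
    eLpNorm (fun ξ : ℝ => ((√|ξ| : ℝ) : ℂ) * (𝓕 (toC w) : L2C) ξ) 2 volume ≤ normX 2 1 w := by
  refine le_trans ?_ (le_self_add (a := sobolevNorm 2 w))
  simpa using eLpNorm_symbol_mul_fourier_le (s := 2) w (m := fun ξ : ℝ => ((√|ξ| : ℝ) : ℂ))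
    (norm_sqrt_abs_le (by norm_num))

theorem toC_hasDerivAt {u v : ℝ → L2R} (hd : HasDerivIntoX 2 1 u v) (t : ℝ) :
    HasDerivAt (fun τ => toC (u τ)) (toC (v t)) t :=
  hd.hasDerivAt_mul (f := toC) (m := fun _ => 1) (z := fun τ => toC (v τ)) toC_sub toC_smul
    eLpNorm_toC_le (fun _ => Eventually.of_forall fun x => by simp)
    (fun _ => Eventually.of_forall fun x => by simp) t

theorem position_hasDerivAt {u v : ℝ → L2R} (hd : HasDerivIntoX 2 1 u v) {y z : ℝ → L2C}
    (hy : ∀ t, ∀ᵐ x : ℝ, y t x = x * toC (u t) x) (hz : ∀ t, ∀ᵐ x : ℝ, z t x = x * toC (v t) x)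
    (t : ℝ) : HasDerivAt y (z t) t :=
  hd.hasDerivAt_mul (f := toC) (m := fun x => (x : ℂ)) toC_sub toC_smul eLpNorm_mul_toC_le hy hz t

theorem halfDeriv_hasDerivAt {u v : ℝ → L2R} (hd : HasDerivIntoX 2 1 u v) {a b : ℝ → L2C}
    (ha : ∀ t, ∀ᵐ ξ : ℝ, a t ξ = ((√|ξ| : ℝ) : ℂ) * (𝓕 (toC (u t)) : L2C) ξ)
    (hb : ∀ t, ∀ᵐ ξ : ℝ, b t ξ = ((√|ξ| : ℝ) : ℂ) * (𝓕 (toC (v t)) : L2C) ξ)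
    (t : ℝ) : HasDerivAt a (b t) t :=
  hd.hasDerivAt_mul (f := fun w => 𝓕 (toC w)) (m := fun ξ => ((√|ξ| : ℝ) : ℂ))
    (fun w z => by rw [toC_sub]; exact (Lp.fourierTransformₗᵢ ℝ ℂ).map_sub _ _)
    (fun c w => by
      rw [toC_smul]
      exact (Lp.fourierTransformₗᵢ ℝ ℂ).map_smul (c : ℂ) (toC w))
    eLpNorm_sqrt_mul_fourier_le ha hb t

theorem re_inner_hasDerivAt {f g : ℝ → L2C} {f' g' : L2C} {t : ℝ} (hf : HasDerivAt f f' t)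
    (hg : HasDerivAt g g' t) :
    HasDerivAt (fun τ => (inner ℂ (f τ) (g τ) : ℂ).re)
      ((inner ℂ (f t) g' : ℂ).re + (inner ℂ f' (g t) : ℂ).re) t := by
  have h := Complex.reCLM.hasFDerivAt.comp_hasDerivAt t (hf.inner ℂ hg)
  simpa using! h

theorem norm_sq_hasDerivAt {f : ℝ → L2C} {f' : L2C} {t : ℝ} (hf : HasDerivAt f f' t) :
    HasDerivAt (fun τ => ‖f τ‖ ^ 2) (2 * (inner ℂ (f t) f' : ℂ).re) t := by
  have h := re_inner_hasDerivAt hf hf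
  simp only [re_inner_self] at h
  refine h.congr_deriv ?_
  have e : (inner ℂ f' (f t) : ℂ).re = (inner ℂ (f t) f' : ℂ).re :=
    inner_re_symm (𝕜 := ℂ) f' (f t)
  rw [e, two_mul]

theorem hasDerivAt_of_toC {u : ℝ → L2R} {v : L2R} {t : ℝ}
    (h : HasDerivAt (fun τ => toC (u τ)) (toC v) t) : HasDerivAt u v t := by
  rw [hasDerivAt_iff_tendsto_slope_zero, tendsto_iff_norm_sub_tendsto_zero] at h ⊢
  refine h.congr fun s => ?_
  rw [← toC_sub, ← toC_smul, ← toC_sub, norm_toC]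

/-- The solution is bounded, locally uniformly in time. -/
theorem eventually_ae_bound {u : ℝ → L2R} (hu : ContinuousIntoX 4 2 u) (t : ℝ) :
    ∃ R : ℝ, ∀ᶠ τ in 𝓝 t, ∀ᵐ x : ℝ, |u τ x| ≤ R := by
  obtain ⟨C, hC, hb⟩ := exists_ae_bound
  have h2 : ∀ {w : L2R}, normX 4 2 w < ∞ → sobolevNorm 2 w < ∞ := fun {w} hw =>
    (sobolevNorm_mono (show (2 : ℝ) ≤ 4 by norm_num) w).trans_lt (lt_of_le_of_lt le_self_add hw)
  set s := C * sobolevNorm 2 (u t) + C * 1 with hs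
  have hs_top : s ≠ ∞ := by
    rw [hs]
    exact ENNReal.add_ne_top.2 ⟨ENNReal.mul_ne_top hC (h2 (hu t).1).ne, by simpa using hC⟩
  refine ⟨s.toReal, ?_⟩
  filter_upwards [(hu t).2.eventually (gt_mem_nhds zero_lt_one)] with τ hτ
  have hd : sobolevNorm 2 (u τ - u t) ≤ 1 :=
    (sobolevNorm_mono (show (2 : ℝ) ≤ 4 by norm_num) _).trans (le_self_add.trans hτ.le)
  filter_upwards [hb _ (h2 (hu t).1), hb (u τ - u t) (hd.trans_lt ENNReal.one_lt_top),
    Lp.coeFn_sub (u τ) (u t)] with x e1 e2 e3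
  have e4 : ‖u τ x‖ₑ ≤ s := by
    have : u τ x = u t x + (u τ - u t) x := by rw [e3, Pi.sub_apply]; ring
    rw [this]
    exact (enorm_add_le _ _).trans (add_le_add e1 (e2.trans (by gcongr)))
  have := ENNReal.toReal_mono hs_top e4
  simpa using this

theorem Nonlinearity.exists_taylor_bound {g g' G K : ℝ → ℝ} (hN : Nonlinearity g g' G K) (R : ℝ) :
    ∃ C, 0 ≤ C ∧ ∀ s r, |s| ≤ R → |r| ≤ R → |G r - G s - g s * (r - s)| ≤ C * (r - s) ^ 2 := by
  obtain ⟨C, hC0, hC⟩ := hN.exists_bounds R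
  refine ⟨C, hC0, fun s r hs hr => ?_⟩
  have hsub : Set.uIcc s r ⊆ Set.Icc (-R) R :=
    Set.uIcc_subset_Icc (abs_le.1 hs) (abs_le.1 hr)
  have hg : ∀ q ∈ Set.uIcc s r, |g q - g s| ≤ C * |r - s| := by
    intro q hq
    have h := Convex.norm_image_sub_le_of_norm_hasDerivWithin_le (f := g) (f' := g')
      (s := Set.Icc (-R) R) (C := C) (x := s) (y := q)
      (fun _ _ => (hN.hasDerivAt _).hasDerivWithinAt) (fun x hx => (hC x (abs_le.2 hx)).2.2.1)
      (convex_Icc _ _) (abs_le.1 hs) (hsub hq)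
    refine h.trans ?_
    gcongr
    exact Set.abs_sub_left_of_mem_uIcc hq
  have h := Convex.norm_image_sub_le_of_norm_hasDerivWithin_le
    (f := fun q => G q - g s * q) (f' := fun q => g q - g s)
    (s := Set.uIcc s r) (C := C * |r - s|) (x := s) (y := r)
    (fun q _ => by
      have := (hN.hasDerivAt_G q).sub ((hasDerivAt_id q).const_mul (g s))
      simpa using! this.hasDerivWithinAt) hg
    (convex_uIcc _ _) Set.left_mem_uIcc Set.right_mem_uIcc
  calc |G r - G s - g s * (r - s)| = ‖(G r - g s * r) - (G s - g s * s)‖ := by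
        rw [norm_eq_abs]; congr 1; ring
    _ ≤ _ := h
    _ = _ := by rw [norm_eq_abs, mul_assoc, abs_mul_abs_self, sq]

theorem memLp_comp_of_bound {f : ℝ → ℝ} (hf : Continuous f) {w : L2R} {R C : ℝ}
    (hR : ∀ᵐ x : ℝ, |w x| ≤ R) (hC : ∀ s, |s| ≤ R → |f s| ≤ C * |s|) :
    MemLp (fun x => f (w x)) 2 volume :=
  (Lp.memLp w).of_le_mul (c := C) (hf.comp_aestronglyMeasurable (Lp.aestronglyMeasurable w))
    (hR.mono fun _ hx => hC _ hx)

theorem integrable_comp_of_bound {f : ℝ → ℝ} (hf : Continuous f) {w : L2R} {R C : ℝ}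
    (hR : ∀ᵐ x : ℝ, |w x| ≤ R) (hC : ∀ s, |s| ≤ R → |f s| ≤ C * s ^ 2) :
    Integrable (fun x => f (w x)) :=
  ((Lp.memLp w).integrable_sq.const_mul C).mono'
    (hf.comp_aestronglyMeasurable (Lp.aestronglyMeasurable w)) (hR.mono fun _ hx => hC _ hx)

/-- The potential energy `∫ G(u)` is differentiable in time with derivative `∫ g(u) ∂ₜ u`. -/
theorem potential_hasDerivAt {g g' G K : ℝ → ℝ} (hN : Nonlinearity g g' G K) {u v : ℝ → L2R}
    (hu : ContinuousIntoX 4 2 u) (hd : HasDerivIntoX 2 1 u v) (t : ℝ) :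
    HasDerivAt (fun τ => ∫ x, G (u τ x)) (∫ x, g (u t x) * v t x) t := by
  obtain ⟨R, hR⟩ := eventually_ae_bound hu t
  have hRt : ∀ᵐ x : ℝ, |u t x| ≤ R := hR.self_of_nhds
  obtain ⟨C, hC0, hC⟩ := hN.exists_bounds R
  obtain ⟨C₂, hC₂0, hC₂⟩ := hN.exists_taylor_bound R
  have hgc : Continuous g := continuous_iff_continuousAt.2 fun x => (hN.hasDerivAt x).continuousAt
  have hGc : Continuous G := continuous_iff_continuousAt.2 fun x => (hN.hasDerivAt_G x).continuousAt
  have hgu := memLp_comp_of_bound hgc hRt fun s hs => (hC s hs).1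
  set ℓ : L2R := hgu.toLp _ with hℓ
  have hℓc : ℓ =ᵐ[volume] _ := hgu.coeFn_toLp
  have hinner : ∀ w : L2R, inner ℝ ℓ w = ∫ x, g (u t x) * w x := by
    intro w
    rw [L2.inner_def]
    refine integral_congr_ae (hℓc.mono fun x hx => ?_)
    simp [hx, mul_comm]
  have hud : HasDerivAt u (v t) t := hasDerivAt_of_toC (toC_hasDerivAt hd t)
  have h1 : HasDerivAt (fun τ => inner ℝ ℓ (u τ)) (inner ℝ ℓ (v t)) t := by
    simpa using (hasDerivAt_const t ℓ).inner ℝ hud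
  have h2 : HasDerivAt (fun τ => (∫ x, G (u τ x)) - inner ℝ ℓ (u τ)) 0 t := by
    have hle : ∀ᶠ τ in 𝓝 t, ‖((∫ x, G (u τ x)) - inner ℝ ℓ (u τ)) -
        ((∫ x, G (u t x)) - inner ℝ ℓ (u t)) - (τ - t) • (0 : ℝ)‖ ≤
        C₂ * ‖‖u τ - u t‖ ^ 2‖ := by
      filter_upwards [hR] with τ hτ
      have hi1 := integrable_comp_of_bound hGc hτ fun s hs => (hC s hs).2.2.2.1
      have hi2 := integrable_comp_of_bound hGc hRt fun s hs => (hC s hs).2.2.2.1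
      have hi3 : Integrable (fun x => g (u t x) * (u τ - u t) x) :=
        hgu.integrable_mul (Lp.memLp (u τ - u t))
      have e : ((∫ x, G (u τ x)) - inner ℝ ℓ (u τ)) - ((∫ x, G (u t x)) - inner ℝ ℓ (u t)) -
          (τ - t) • (0 : ℝ) = ∫ x, (G (u τ x) - G (u t x) - g (u t x) * (u τ - u t) x) := by
        have hi12 : Integrable (fun x => G (u τ x) - G (u t x)) := hi1.sub hi2
        rw [integral_sub hi12 hi3, integral_sub hi1 hi2, ← hinner, inner_sub_right]
        simp only [smul_zero]
        ring
      have hsq : ∫ x, (u τ - u t) x ^ 2 = ‖u τ - u t‖ ^ 2 := by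
        rw [← real_inner_self_eq_norm_sq, L2.inner_def]
        exact integral_congr_ae (Eventually.of_forall fun x => by simp [sq])
      rw [e, norm_of_nonneg (by positivity : 0 ≤ ‖u τ - u t‖ ^ 2), ← hsq, ← integral_const_mul]
      refine norm_integral_le_of_norm_le ((Lp.memLp (u τ - u t)).integrable_sq.const_mul C₂) ?_
      filter_upwards [hτ, hRt, Lp.coeFn_sub (u τ) (u t)] with x k1 k2 k3
      rw [k3]
      exact hC₂ _ _ k2 k1
    rw [hasDerivAt_iff_isLittleO]
    refine (Asymptotics.IsBigO.of_bound C₂ hle).trans_isLittleO ?_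
    have hO : (fun τ => ‖u τ - u t‖ ^ 2) =O[𝓝 t] fun τ => (τ - t) ^ 2 :=
      (hud.isBigO_sub.norm_left).pow 2
    refine hO.trans_isLittleO ?_
    have ht : Tendsto (fun τ => τ - t) (𝓝 t) (𝓝 0) := by
      simpa using (continuous_id.sub continuous_const).tendsto (x := t) (f := fun τ => τ - t)
    exact (Asymptotics.isLittleO_pow_id one_lt_two).comp_tendsto ht
  have h3 := h2.add h1
  simp only [zero_add, hinner (v t)] at h3
  refine h3.congr_of_eventuallyEq (Eventually.of_forall fun τ => ?_)
  simp

/-! ### Smallness for all times and monotonicity of the virial quantity -/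

theorem lintegral_weight_eq {f : L2R} {a : L2C}
    (ha : ∀ᵐ ξ : ℝ, a ξ = ((√|ξ| : ℝ) : ℂ) * (𝓕 (toC f) : L2C) ξ) :
    ∫⁻ ξ, ENNReal.ofReal |ξ| * ‖(𝓕 (toC f) : L2C) ξ‖ₑ ^ 2 = ENNReal.ofReal (‖a‖ ^ 2) := by
  rw [ENNReal.ofReal_pow (norm_nonneg _), ofReal_norm, ← lintegral_enorm_sq_eq]
  refine lintegral_congr_ae (ha.mono fun ξ hξ => ?_)
  simp only [hξ, enorm_mul, mul_pow]
  congr 1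
  rw [← ofReal_norm, Complex.norm_real, norm_of_nonneg (sqrt_nonneg _),
    ← ENNReal.ofReal_pow (sqrt_nonneg _), sq_sqrt (abs_nonneg _)]

theorem lintegral_one_add_weight_eq {f : L2R} {a : L2C}
    (ha : ∀ᵐ ξ : ℝ, a ξ = ((√|ξ| : ℝ) : ℂ) * (𝓕 (toC f) : L2C) ξ) :
    ∫⁻ ξ, ENNReal.ofReal (1 + |ξ|) * ‖(𝓕 (toC f) : L2C) ξ‖ₑ ^ 2 =
      ENNReal.ofReal (‖toC f‖ ^ 2 + ‖a‖ ^ 2) := by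
  rw [ENNReal.ofReal_add (by positivity) (by positivity), ← lintegral_weight_eq ha,
    ENNReal.ofReal_pow (norm_nonneg _), ofReal_norm, ← lintegral_enorm_sq_eq,
    ← lintegral_fourier_enorm_sq, ← lintegral_add_left']
  · refine lintegral_congr fun ξ => ?_
    rw [ENNReal.ofReal_add zero_le_one (abs_nonneg _), ENNReal.ofReal_one, add_mul, one_mul]
  · exact (Lp.aestronglyMeasurable _).enorm.pow_const _

/-- For small functions in `H^{1/2}`, integrals of monomials of degree at least four are small
multiples of `‖D^{1/2} f‖₂²`. -/
theorem lintegral_enorm_pow_le_of_small (n : ℕ) {f : L2R} {a : L2C}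
    (ha : ∀ᵐ ξ : ℝ, a ξ = ((√|ξ| : ℝ) : ℂ) * (𝓕 (toC f) : L2C) ξ) {B : ℝ} (hB : 0 < B)
    (hB1 : B ≤ 1) (h : ‖toC f‖ ^ 2 + ‖a‖ ^ 2 ≤ B) :
    ∫⁻ x, ‖f x‖ₑ ^ (n + 4) ≤ ENNReal.ofReal
      (4 * (n + 4) / (n + 2) * √(4 * (n + 2)) ^ (n + 2) * B * ‖a‖ ^ 2) := by
  have e : ∫⁻ x, ‖f x‖ₑ ^ (n + 4) = ∫⁻ x, ‖toC f x‖ₑ ^ (n + 4) := by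
    refine lintegral_congr_ae ((toC_coe f).mono fun x hx => ?_)
    simp only [hx]
    rw [← ofReal_norm, ← ofReal_norm, Complex.norm_real]
  rw [e]
  refine (lintegral_enorm_pow_le n (toC f) hB
    ((lintegral_one_add_weight_eq ha).le.trans (ENNReal.ofReal_le_ofReal h))).trans ?_
  rw [lintegral_weight_eq ha, ← ENNReal.ofReal_mul (by positivity)]
  refine ENNReal.ofReal_le_ofReal ?_
  rw [mul_assoc _ _ B]
  gcongr
  rw [show 4 * B * ((n : ℝ) + 2) = (4 * (n + 2)) * B by ring, sqrt_mul (by positivity), mul_pow]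
  gcongr
  calc √B ^ (n + 2) ≤ √B ^ 2 :=
        pow_le_pow_of_le_one (sqrt_nonneg _) (sqrt_le_one.2 hB1) (by omega)
    _ = B := sq_sqrt hB.le

/-- For a polynomial whose monomials have degree at least four, the integral of its values at a
small function `f` is a small multiple of `‖D^{1/2} f‖₂²`. -/
theorem exists_abs_integral_sum_le (S : Finset ℕ) (hS : ∀ j ∈ S, 3 ≤ j) (c : ℕ → ℝ) :
    ∃ C, 0 ≤ C ∧ ∀ (f : L2R) (a : L2C) (B : ℝ),
      (∀ᵐ ξ : ℝ, a ξ = ((√|ξ| : ℝ) : ℂ) * (𝓕 (toC f) : L2C) ξ) → 0 < B → B ≤ 1 →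
      ‖toC f‖ ^ 2 + ‖a‖ ^ 2 ≤ B →
      |∫ x, ∑ j ∈ S, c j * f x ^ (j + 1)| ≤ C * B * ‖a‖ ^ 2 := by
  set d : ℕ → ℝ := fun n => 4 * (n + 4) / (n + 2) * √(4 * (n + 2)) ^ (n + 2) with hd
  have hd0 : ∀ n, 0 ≤ d n := fun n => by simp only [hd]; positivity
  refine ⟨∑ j ∈ S, |c j| * d (j - 3), Finset.sum_nonneg fun j _ =>
    mul_nonneg (abs_nonneg _) (hd0 _), fun f a B ha hB hB1 h => ?_⟩
  have h1 : ∫⁻ x, ‖∑ j ∈ S, c j * f x ^ (j + 1)‖ₑ ≤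
      ENNReal.ofReal ((∑ j ∈ S, |c j| * d (j - 3)) * B * ‖a‖ ^ 2) := by
    calc _ ≤ ∫⁻ x, ∑ j ∈ S, ENNReal.ofReal |c j| * ‖f x‖ₑ ^ (j + 1) := by
          refine lintegral_mono fun x => (enorm_sum_le _ _).trans (le_of_eq ?_)
          refine Finset.sum_congr rfl fun j _ => ?_
          rw [enorm_mul, enorm_pow, ← ofReal_norm (c j), norm_eq_abs]
      _ = ∑ j ∈ S, ENNReal.ofReal |c j| * ∫⁻ x, ‖f x‖ₑ ^ (j + 1) := by
          rw [lintegral_finsetSum' _ fun j _ =>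
            ((Lp.aestronglyMeasurable f).enorm.pow_const _).const_mul _]
          exact Finset.sum_congr rfl fun j _ => lintegral_const_mul' _ _ ENNReal.ofReal_ne_top
      _ ≤ ∑ j ∈ S, ENNReal.ofReal (|c j| * d (j - 3) * B * ‖a‖ ^ 2) := by
          refine Finset.sum_le_sum fun j hj => ?_
          have h4 : j + 1 = (j - 3) + 4 := by have := hS j hj; omega
          rw [h4, mul_assoc, mul_assoc, ENNReal.ofReal_mul (abs_nonneg _), ← mul_assoc (d _)]
          gcongr
          exact lintegral_enorm_pow_le_of_small (j - 3) ha hB hB1 h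
      _ = _ := by
          rw [← ENNReal.ofReal_sum_of_nonneg, Finset.sum_mul, Finset.sum_mul]
          intro j _
          have := hd0 (j - 3)
          positivity
  rw [← norm_eq_abs]
  refine (norm_integral_le_lintegral_norm _).trans ?_
  refine ENNReal.toReal_le_of_le_ofReal ?_ ?_
  · have : 0 ≤ ∑ j ∈ S, |c j| * d (j - 3) :=
      Finset.sum_nonneg fun j _ => mul_nonneg (abs_nonneg _) (hd0 _)
    positivity
  · simpa only [ofReal_norm] using h1

theorem eq_of_monotone_of_periodic {V : ℝ → ℝ} (hm : Monotone V) {ω : ℝ} (hω : 0 < ω)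
    (hp : Function.Periodic V ω) (s t : ℝ) : V s = V t := by
  have key : ∀ s t, V s ≤ V t := by
    intro s t
    obtain ⟨n, hn⟩ := Archimedean.arch (s - t) hω
    calc V s ≤ V (t + n • ω) := hm (by linarith)
      _ = V t := hp.nsmul n t
  exact le_antisymm (key s t) (key t s)

/-- A continuous quantity `M + A`, with `M` conserved and `c A ≤ E ≤ 3 c A` for a conserved `E`
as long as `M + A ≤ η`, remains below `η` if it is initially below `η / 3`. -/
theorem lt_of_conserved {M A E : ℝ → ℝ} {c η : ℝ} (hc : 0 < c) (hM : ∀ t, M t = M 0)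
    (hE : ∀ t, E t = E 0) (hM0 : 0 ≤ M 0) (hA0 : 0 ≤ A 0) (hA : Continuous A)
    (hbd : ∀ t, M t + A t ≤ η → c * A t ≤ E t ∧ E t ≤ 3 * (c * A t)) (h0 : M 0 + A 0 < η / 3)
    (t : ℝ) : M t + A t < η := by
  by_contra! ht
  have hcont : Continuous fun t => M t + A t := by
    simp only [hM]
    exact continuous_const.add hA
  obtain ⟨s, hs⟩ : η ∈ Set.range fun t => M t + A t :=
    mem_range_of_exists_le_of_exists_ge hcont ⟨0, by linarith⟩ ⟨t, ht⟩
  have hs' : M s + A s = η := hs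
  have h1 := (hbd s hs'.le).1
  have h2 := (hbd 0 (by linarith)).2
  rw [hE s] at h1
  have h3 : A s ≤ 3 * A 0 := by
    refine le_of_mul_le_mul_left ?_ hc
    linarith
  rw [hM s] at hs'
  linarith

theorem toLp_coe {f : ℝ → ℂ} (h : MemLp f 2 volume) : ∀ᵐ x : ℝ, h.toLp f x = f x :=
  h.coeFn_toLp

/-- Non-existence of small time-periodic solutions for a nonlinearity whose potentials `G` and `K`
are dominated by `‖D^{1/2} u‖₂²` for small `u`. -/
theorem not_timePeriodic_of_bound {g g' G K : ℝ → ℝ} (hN : Nonlinearity g g' G K) {C η : ℝ}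
    (hη : 0 < η) (hCη : C * η ≤ π / 2)
    (hGK : ∀ (f : L2R) (a : L2C), (∀ᵐ ξ : ℝ, a ξ = ((√|ξ| : ℝ) : ℂ) * (𝓕 (toC f) : L2C) ξ) →
      ‖toC f‖ ^ 2 + ‖a‖ ^ 2 ≤ η →
      |∫ x, G (f x)| ≤ C * η * ‖a‖ ^ 2 ∧ |∫ x, K (f x)| ≤ C * η * ‖a‖ ^ 2)
    {u v : ℝ → L2R} (hu : ContinuousIntoX 4 2 u) (hd : HasDerivIntoX 2 1 u v)
    (he : ∀ t, Equation g (u t) (v t)) (h0 : sobolevNorm (1 / 2) (u 0) ≠ 0)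
    (hsmall : sobolevNorm (1 / 2) (u 0) < ENNReal.ofReal √(η / 6)) : ¬ TimePeriodic u := by
  rintro ⟨ω, hω, hper⟩
  have hs2 : ∀ w : L2R, normX 2 1 w < ∞ → sobolevNorm 2 w < ∞ := fun w hw =>
    lt_of_le_of_lt le_self_add hw
  have hs4 : ∀ t, sobolevNorm 4 (u t) < ∞ := fun t => lt_of_le_of_lt le_self_add (hu t).1
  have hw : ∀ t, weightNorm 2 (u t) < ∞ := fun t => lt_of_le_of_lt le_add_self (hu t).1
  have hwv : ∀ t, weightNorm 1 (v t) < ∞ := fun t => lt_of_le_of_lt le_add_self (hd t).2.1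
  have hhalf : ∀ w : L2R, normX 2 1 w < ∞ →
      MemLp (fun ξ : ℝ => ((√|ξ| : ℝ) : ℂ) * (𝓕 (toC w) : L2C) ξ) 2 volume := fun w hw =>
    memLp_symbol_mul_fourier (hs2 w hw) (by fun_prop) (norm_sqrt_abs_le (by norm_num))
  -- `a = D^{1/2} u` and `y = x u`, with time derivatives `b` and `z`
  set a : ℝ → L2C := fun t => (hhalf (u t) (hd t).1).toLp _
  set b : ℝ → L2C := fun t => (hhalf (v t) (hd t).2.1).toLp _
  set y : ℝ → L2C := fun t => (memLp_mul_of_weight (hw t)).toLp _ with hy_def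
  set z : ℝ → L2C := fun t => (memLp_mul_of_weight_one (hwv t)).toLp _
  have ha : ∀ t, ∀ᵐ ξ : ℝ, a t ξ = ((√|ξ| : ℝ) : ℂ) * (𝓕 (toC (u t)) : L2C) ξ :=
    fun t => toLp_coe _
  have hb : ∀ t, ∀ᵐ ξ : ℝ, b t ξ = ((√|ξ| : ℝ) : ℂ) * (𝓕 (toC (v t)) : L2C) ξ :=
    fun t => toLp_coe _
  have hy : ∀ t, ∀ᵐ x : ℝ, y t x = x * toC (u t) x := fun t => toLp_coe _
  have hz : ∀ t, ∀ᵐ x : ℝ, z t x = x * toC (v t) x := fun t => toLp_coe _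
  have hda := halfDeriv_hasDerivAt hd ha hb
  have hdy := position_hasDerivAt hd hy hz
  have hdu := toC_hasDerivAt hd
  have hconst : ∀ {f : ℝ → ℝ}, (∀ t, HasDerivAt f 0 t) → ∀ t, f t = f 0 := fun {f} hf t =>
    is_const_of_deriv_eq_zero (fun t => (hf t).differentiableAt) (fun t => (hf t).deriv) t 0
  have hM : ∀ t, ‖toC (u t)‖ ^ 2 = ‖toC (u 0)‖ ^ 2 := hconst fun t =>
    (norm_sq_hasDerivAt (hdu t)).congr_deriv (by rw [mass_identity hN (hs4 t) (he t), mul_zero])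
  have hE : ∀ t, π * ‖a t‖ ^ 2 + ∫ x, G (u t x) = π * ‖a 0‖ ^ 2 + ∫ x, G (u 0 x) :=
    hconst fun t => (((norm_sq_hasDerivAt (hda t)).const_mul π).add
      (potential_hasDerivAt hN hu hd t)).congr_deriv (by
        rw [← energy_identity (he t) (ha t) (hb t)]; ring)
  have hAc : Continuous fun t => ‖a t‖ ^ 2 :=
    continuous_iff_continuousAt.2 fun t => (norm_sq_hasDerivAt (hda t)).continuousAt
  have hGb : ∀ t, ‖toC (u t)‖ ^ 2 + ‖a t‖ ^ 2 ≤ η →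
      |∫ x, G (u t x)| ≤ π / 2 * ‖a t‖ ^ 2 ∧ |∫ x, K (u t x)| ≤ π / 2 * ‖a t‖ ^ 2 := by
    intro t ht
    obtain ⟨k1, k2⟩ := hGK (u t) (a t) (ha t) ht
    exact ⟨k1.trans (by gcongr), k2.trans (by gcongr)⟩
  have hinit : ‖toC (u 0)‖ ^ 2 + ‖a 0‖ ^ 2 < η / 3 := by
    have hlt : ∀ w : L2C, ‖w‖ₑ ≤ sobolevNorm (1 / 2) (u 0) → ‖w‖ ^ 2 < η / 6 := by
      intro w hw
      have := hw.trans_lt hsmall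
      rw [← ofReal_norm, ENNReal.ofReal_lt_ofReal_iff_of_nonneg (norm_nonneg _)] at this
      calc ‖w‖ ^ 2 < √(η / 6) ^ 2 := by gcongr
        _ = η / 6 := sq_sqrt (by positivity)
    have k1 : ‖toC (u 0)‖ ^ 2 < η / 6 := by
      rw [← Lp.norm_fourier_eq]
      refine hlt _ ?_
      rw [Lp.enorm_def]
      have := eLpNorm_symbol_mul_fourier_le (s := 1 / 2) (C := 1) (u 0) (m := fun _ => 1) fun ξ => by
        rw [norm_one, one_mul]
        exact one_le_rpow (by nlinarith [sq_nonneg ξ]) (by norm_num)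
      simpa using this
    have k2 : ‖a 0‖ ^ 2 < η / 6 := by
      refine hlt _ ?_
      rw [Lp.enorm_def, eLpNorm_congr_ae (ha 0)]
      simpa using eLpNorm_symbol_mul_fourier_le (s := 1 / 2) (u 0)
        (m := fun ξ : ℝ => ((√|ξ| : ℝ) : ℂ)) (norm_sqrt_abs_le le_rfl)
    linarith
  have hsm : ∀ t, ‖toC (u t)‖ ^ 2 + ‖a t‖ ^ 2 < η :=
    lt_of_conserved (M := fun t => ‖toC (u t)‖ ^ 2) (A := fun t => ‖a t‖ ^ 2)
      (E := fun t => π * ‖a t‖ ^ 2 + ∫ x, G (u t x)) (c := π / 2) (by positivity) hM hE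
      (by positivity) (by positivity) hAc (fun t ht => by
        have := abs_le.1 (hGb t ht).1
        constructor <;> linarith [this.1, this.2]) hinit
  -- the virial quantity `∫ x u²` is monotone and periodic
  set V : ℝ → ℝ := fun t => (inner ℂ (y t) (toC (u t)) : ℂ).re with hV
  have hVd : ∀ t, HasDerivAt V (2 * (2 * π * ‖a t‖ ^ 2 + ∫ x, K (u t x))) t := by
    intro t
    refine (re_inner_hasDerivAt (hdy t) (hdu t)).congr_deriv ?_
    have e : (inner ℂ (z t) (toC (u t)) : ℂ).re = (inner ℂ (y t) (toC (v t)) : ℂ).re := by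
      rw [re_inner_eq, re_inner_eq]
      refine integral_congr_ae ?_
      filter_upwards [hy t, hz t] with x k1 k2
      rw [k1, k2]
      simp only [Complex.mul_re, Complex.mul_im, Complex.ofReal_re, Complex.ofReal_im]
      ring
    rw [e, virial_identity hN (hu t).1 (he t) (hy t) (ha t)]
    ring
  have hVnn : ∀ t, 3 * π * ‖a t‖ ^ 2 ≤ 2 * (2 * π * ‖a t‖ ^ 2 + ∫ x, K (u t x)) := by
    intro t
    have := (abs_le.1 (hGb t (hsm t).le).2).1
    linarith
  have hVm : Monotone V := monotone_of_hasDerivAt_nonneg hVd fun t =>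
    le_trans (by positivity) (hVnn t)
  have hVp : Function.Periodic V ω := fun t => by
    simp only [hV, hy_def, hper t]
  have hV0 : HasDerivAt V 0 0 := by
    have : V = fun _ => V 0 := funext fun t => eq_of_monotone_of_periodic hVm hω hVp t 0
    rw [this]
    exact hasDerivAt_const _ _
  have ha0 : ‖a 0‖ = 0 := by
    have h1 := hVnn 0
    rw [(hVd 0).unique hV0] at h1
    have h2 : ‖a 0‖ ^ 2 ≤ 0 := by
      by_contra! h
      have := mul_pos (mul_pos three_pos pi_pos) h
      linarith
    exact pow_eq_zero_iff two_ne_zero |>.1 (le_antisymm h2 (sq_nonneg _))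
  have hzero : ∀ᵐ ξ : ℝ, (𝓕 (toC (u 0)) : L2C) ξ = 0 := by
    rw [norm_eq_zero] at ha0
    have h1 := ha 0
    rw [ha0] at h1
    filter_upwards [h1, Lp.coeFn_zero ℂ 2 (volume : Measure ℝ),
      show ∀ᵐ ξ : ℝ, ξ ≠ 0 from by simp [ae_iff]] with ξ k1 k2 k3
    rw [k2] at k1
    have : ((√|ξ| : ℝ) : ℂ) ≠ 0 := by
      exact_mod_cast (sqrt_pos.2 (abs_pos.2 k3)).ne'
    simpa [this] using k1.symm
  refine h0 ?_
  unfold sobolevNorm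
  rw [eLpNorm_congr_ae (g := fun _ => (0 : ℂ)) (hzero.mono fun ξ hξ => by simp only [hξ, mul_zero])]
  simp

/-- The polynomials with monomials of degree at least three only, with the primitives `G` and
`K`. -/
theorem nonlinearity_sum (S : Finset ℕ) (hS : ∀ j ∈ S, 3 ≤ j) (c : ℕ → ℝ) :
    Nonlinearity (fun s => ∑ j ∈ S, c j * s ^ j) (fun s => ∑ j ∈ S, c j * (j * s ^ (j - 1)))
      (fun s => ∑ j ∈ S, c j / (j + 1) * s ^ (j + 1))
      (fun s => ∑ j ∈ S, c j * j / (j + 1) * s ^ (j + 1)) where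
  hasDerivAt s := HasDerivAt.fun_sum fun j _ => (hasDerivAt_pow j s).const_mul (c j)
  continuous_deriv := by fun_prop
  hasDerivAt_G s := HasDerivAt.fun_sum fun j _ =>
    ((hasDerivAt_pow (j + 1) s).const_mul (c j / (j + 1))).congr_deriv (by
      have : (j : ℝ) + 1 ≠ 0 := by positivity
      push_cast
      field_simp)
  hasDerivAt_K s := by
    have h : HasDerivAt (fun s : ℝ => ∑ j ∈ S, c j * j / (j + 1) * s ^ (j + 1))
        (∑ j ∈ S, s * (c j * (j * s ^ (j - 1)))) s := HasDerivAt.fun_sum fun j hj =>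
      ((hasDerivAt_pow (j + 1) s).const_mul (c j * j / (j + 1))).congr_deriv (by
        have h1 : (j : ℝ) + 1 ≠ 0 := by positivity
        have h2 : s ^ j = s * s ^ (j - 1) := by
          rw [← pow_succ', Nat.sub_add_cancel (by have := hS j hj; omega)]
        push_cast
        rw [h2]
        field_simp)
    rwa [← Finset.mul_sum] at h
  map_zero := Finset.sum_eq_zero fun j hj => by
    rw [zero_pow (by have := hS j hj; omega), mul_zero]
  G_zero := Finset.sum_eq_zero fun j _ => by simp
  K_zero := Finset.sum_eq_zero fun j _ => by simp

theorem pow_add_perturbation (k m : ℕ) (a : ℕ → ℝ) (s : ℝ) :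
    s ^ k + perturbation k m a s =
      ∑ j ∈ insert k (Finset.Icc (k + 1) m), (if j = k then 1 else a j) * s ^ j := by
  rw [Finset.sum_insert (by simp), if_pos rfl, one_mul, perturbation]
  congr 1
  refine Finset.sum_congr rfl fun j hj => ?_
  rw [if_neg (by have := (Finset.mem_Icc.1 hj).1; omega)]

end GBO

theorem theorem1p3 (k : ℕ) (hk : 3 ≤ k) (m : ℕ) (a : ℕ → ℝ) :
    ∃ ε : ℝ, 0 < ε ∧
      ∀ (u₀ : GBO.L2R) (u : ℝ → GBO.L2R),
        GBO.IsSolution k (GBO.perturbation k m a) u₀ u →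
        GBO.sobolevNorm (1 / 2) u₀ ≠ 0 →
        GBO.sobolevNorm (1 / 2) u₀ < ENNReal.ofReal ε →
        ¬ GBO.TimePeriodic u := by
  set S := insert k (Finset.Icc (k + 1) m)
  set b : ℕ → ℝ := fun j => if j = k then 1 else a j with hb
  have hS : ∀ j ∈ S, 3 ≤ j := by
    intro j hj
    rcases Finset.mem_insert.1 hj with h | h
    · omega
    · have := (Finset.mem_Icc.1 h).1
      omega
  obtain ⟨C₁, hC₁, h₁⟩ := GBO.exists_abs_integral_sum_le S hS fun j => b j / (j + 1)
  obtain ⟨C₂, hC₂, h₂⟩ := GBO.exists_abs_integral_sum_le S hS fun j => b j * j / (j + 1)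
  have hN := GBO.nonlinearity_sum S hS b
  -- any `η ≤ 1` with `(C₁ + C₂) η ≤ π / 2` would do
  set η : ℝ := 1 / (C₁ + C₂ + 1) with hη
  have hη0 : 0 < η := by positivity
  have hη1 : η ≤ 1 := by
    rw [hη, div_le_one (by positivity)]
    linarith
  have hCη : (C₁ + C₂) * η ≤ Real.pi / 2 := by
    have h1 : (C₁ + C₂) * η ≤ 1 := by
      rw [hη, mul_one_div, div_le_one (by positivity)]
      linarith
    linarith [Real.pi_gt_three]
  refine ⟨√(η / 6), by positivity, fun u₀ u hsol hne hlt => ?_⟩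
  obtain ⟨v, hd, -, heq⟩ := hsol.equation
  have hfun : (fun s => s ^ k + GBO.perturbation k m a s) = fun s => ∑ j ∈ S, b j * s ^ j :=
    funext fun s => GBO.pow_add_perturbation k m a s
  rw [hfun] at heq
  rw [← hsol.initial] at hne hlt
  refine GBO.not_timePeriodic_of_bound hN hη0 hCη (fun f w hw hle => ⟨?_, ?_⟩)
    hsol.continuous_H4 hd heq hne hlt
  · refine (h₁ f w η hw hη0 hη1 hle).trans ?_
    gcongr
    linarith
  · refine (h₂ f w η hw hη0 hη1 hle).trans ?_
    gcongr
    linarith
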